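/- **Syntax.** A *signature* assigns to each symbol $S$ an arity $(c,[(c_1,n_1),\dots,(c_k,n_k)])$ with $c\in\{\mathsf{Ty},\mathsf{Tm}\}$ and $c_i\in\{\mathsf{Ty},\mathsf{Tm},\mathsf{EqTy},\mathsf{EqTm}\}$; a metavariable has an arity $(c,n)$, and is an *object* metavariable if $c\in\{\mathsf{Ty},\mathsf{Tm}\}$ and an *equality* metavariable otherwise. Type expressions are $S(e_1,\dots,e_k)$ and $M(t_1,\dots,t_n)$; term expressions are variables, $S(e_1,\dots,e_k)$ and $M(t_1,\dots,t_n)$ (with $S$, $M$ of the appropriate object class and terms $t_i$); an *argument* of arity $(c,n)$ is $\{x_1\}\cdots\{x_n\}e$ with $e$ an expression of class $c$, where the only expression of class $\mathsf{EqTy}$ or $\mathsf{EqTm}$ is the dummy $\star$; the $i$-th argument of $S$ has arity $(c_i,n_i)$. Judgement theses are $A\ \mathsf{type}$, $t:A$, $A\equiv B$, $s\equiv t:A$; boundary theses $\mathcal B$ are $\Box\ \mathsf{type}$, $\Box:A$, $A\equiv B\ \mathsf{by}\ \Box$, $s\equiv t:A\ \mathsf{by}\ \Box$; either may be abstracted by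 $\{x_1{:}A_1\}\cdots\{x_n{:}A_n\}$. $\mathcal B[e]$ is the judgement obtained by filling the boundary $\mathcal B$ with the head $e$, and $\mathcal B[e\equiv e']$ is the equation obtained from an object boundary. Metavariable contexts $\Theta=[M_1{:}\mathcal B_1,\dots,M_n{:}\mathcal B_n]$ consist of closed abstracted boundaries, $\mathcal B_i$ mentioning only $M_j$ with $j<i$; $M_i$ has the arity of $\mathcal B_i$. $\mathrm{objmv}(\Theta)$ is the set of object metavariables of $\Theta$, $\mathrm{mv}(e)$ the set of metavariables occurring in $e$. The generic application $\widehat M$ is $\{\vec x\}M(\vec x)$ for an object metavariable and $\{\vec x\}\star$ for an equality metavariable. An *instantiation* $I=\langle M_i\mapsto e_i\rangle$ of $\Xi$ over $\Theta;\Gamma$ assigns to each $M_i$ of $\Xi$ an argument over $\Theta;\Gamma$ of the same arity; $I_*$ replaces $M_i(\vec t)$ by $e[I_*\vec t/\vec x]$ where $e_i=\{\vec x\}e$; $I{\restriction}i$ is the restriction of $I$ to $M_1,\dots,M_{i-1}$. **Theories.** A *raw rule* is $\Xi\Longrightarrow\mathcal B[e]$ with $\mathcal B$ a boundary thesis, over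 the empty variable context; it is an object rule if $\mathcal B$ is $\Box\ \mathsf{type}$ or $\Box:A$. A *raw type theory* is a family of raw rules. It derives hypothetical judgements and boundaries $\Theta;\Gamma\vdash\cdots$ by the following rules. (1) Structural rules. Variables: $\Theta;\Gamma\vdash a:\Gamma(a)$. Metavariables, for $\Theta(M)=\{x_1{:}A_1\}\cdots\{x_m{:}A_m\}\mathcal B$: from $t_j:A_j[t_1,\dots,t_{j-1}/x_1,\dots,x_{j-1}]$ for all $j$ and $\mathcal B[\vec t/\vec x]$ infer $\mathcal B[\vec t/\vec x]$ filled with $M(\vec t)$ (with $\star$ for an equality metavariable). Metavariable congruence, for $M$ an object metavariable: from $s_j:A_j[s_1,\dots,s_{j-1}/x_1,\dots,x_{j-1}]$, $t_j:A_j[t_1,\dots,t_{j-1}/x_1,\dots,x_{j-1}]$, $s_j\equiv t_j:A_j[s_1,\dots,s_{j-1}/x_1,\dots,x_{j-1}]$ for all $j$, and $C[\vec s/\vec x]\equiv C[\vec t/\vec x]$ if $\mathcal B=(\Box:C)$, infer $\mathcal B[\vec s/\vec x]$ filled with $M(\vec s)\equiv M(\vec t)$. Abstraction (for judgements and likewise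 for boundaries): from $\Gamma\vdash A\ \mathsf{type}$ and $\Gamma,a{:}A\vdash\mathcal J[a/x]$ with $a$ fresh infer $\Gamma\vdash\{x{:}A\}\mathcal J$. Reflexivity, symmetry, transitivity of both equalities, and conversion of $t:A$ and of $s\equiv t:A$ along $A\equiv B$. Boundary theses: $\Box\ \mathsf{type}$ is derivable, $\Box:A$ if $A\ \mathsf{type}$ is, $A\equiv B\ \mathsf{by}\ \Box$ if $A\ \mathsf{type}$ and $B\ \mathsf{type}$ are, $s\equiv t:A\ \mathsf{by}\ \Box$ if $A\ \mathsf{type}$, $s:A$, $t:A$ are. (2) For each rule $[M_i{:}\mathcal B_i]_i\Longrightarrow\mathcal B[e]$ and instantiation $I=\langle M_i\mapsto e_i\rangle$ over $\Theta;\Gamma$: from $((I{\restriction}i)_*\mathcal B_i)[e_i]$ for all $i$ and $I_*\mathcal B$ infer $I_*(\mathcal B[e])$. (3) For each object rule as in (2) and instantiations $I=\langle M_i\mapsto f_i\rangle$, $J=\langle M_i\mapsto g_i\rangle$: from $((I{\restriction}i)_*\mathcal B_i)[f_i]$ and $((J{\restriction}i)_*\mathcal B_i)[g_i]$ for all $i$,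 $((I{\restriction}i)_*\mathcal B_i)[f_i\equiv g_i]$ for all object boundaries $\mathcal B_i$, and $I_*B\equiv J_*B$ if $\mathcal B=(\Box:B)$, infer $(I_*\mathcal B)[I_*e\equiv J_*e]$. $\vdash\Theta\ \mathsf{mctx}$ means that $[M_1{:}\mathcal B_1,\dots,M_{i-1}{:}\mathcal B_{i-1}];[\,]\vdash\mathcal B_i$ is derivable for each $i$. A rule $\Xi\Longrightarrow\mathcal J$ is *derivable* if $\Xi;[\,]\vdash\mathcal J$ is; $\Xi\Longrightarrow\mathcal B[e]$ is *finitary* if $\vdash\Xi\ \mathsf{mctx}$ and $\Xi;[\,]\vdash\mathcal B$. A theory is *standard* if all its rules are finitary, its object rules are symbol rules, i.e. of the form $[M_1{:}\mathcal B_1,\dots,M_n{:}\mathcal B_n]\Longrightarrow\mathcal B[S(\widehat M_1,\dots,\widehat M_n)]$, and each symbol $S$ has precisely one such rule. **Natural types and naturality for variables.** The *natural type* $\tau_{\Theta;\Gamma}(t)$ of a term is $\Gamma(a)$ for $t=a$; $A[\vec t/\vec x]$ for $t=M(\vec t)$ with $\Theta(M)=\{\vec x{:}\vec A\}\,\Box:A$;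 and $\langle M_i\mapsto e_i\rangle_*B$ for $t=S(\vec e)$ with symbol rule $[M_i{:}\mathcal B_i]_i\Longrightarrow S(\widehat M_1,\dots,\widehat M_n):B$. An object judgement is *natural for variables*, $\Theta;\Gamma\vdash_{\mathsf n}\mathcal J$, if it is obtained from the rules: $\vdash_{\mathsf n}a:\Gamma(a)$; if $\Theta;\Gamma,a{:}A\vdash_{\mathsf n}\mathcal J[a/x]$ ($a$ fresh) then $\Theta;\Gamma\vdash_{\mathsf n}\{x{:}A\}\mathcal J$; if $\Theta(M)=\{\vec x{:}\vec A\}\mathcal B$ with $\mathcal B$ an object boundary and $\vdash_{\mathsf n}t_i:A_i[t_1,\dots,t_{i-1}/x_1,\dots,x_{i-1}]$ for all $i$, then $\vdash_{\mathsf n}\mathcal B[\vec t/\vec x]$ filled with $M(\vec t)$; if $S$ has symbol rule with premises $[M_i{:}\mathcal B_i]_i$, $I=\langle M_i\mapsto e_i\rangle$ and $\vdash_{\mathsf n}((I{\restriction}i)_*\mathcal B_i)[e_i]$ for every object boundary $\mathcal B_i$, then $\vdash_{\mathsf n}\mathcal B'[S(\vec e)]$ for every boundary thesis $\mathcal B'$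 of the class of $S$. A rule $\Xi\Longrightarrow\mathcal J$ is natural for variables if $\Xi;[\,]\vdash_{\mathsf n}\mathcal J$. **Patterns.** Type patterns are $P::=M()\mid S(q_1,\dots,q_n)$, term patterns are $p::=S(q_1,\dots,q_n)$, argument patterns are $q::=\{\vec x\}M(\vec x)\mid\{\vec x\}\star\mid P\mid p$ (where $\vec x$ may be empty), always with $\mathrm{mv}(q_i)\cap\mathrm{mv}(q_j)=\emptyset$ for $i\ne j$. **Computation rules.** A rule $\Xi\Longrightarrow\mathcal J$ is *deterministic* if for every judgement $\Theta;\Gamma\vdash\mathcal J'$ there is at most one instantiation $I$ of $\Xi$ over $\Theta;\Gamma$ with $I_*\mathcal J=\mathcal J'$. For an instantiation $I$ of $\Xi=[M_i{:}\mathcal B_i]_i$ over $\Theta;[\,]$, where $\Xi$ and $\Theta$ have no metavariables in common, the *equational residue* is $\Theta$ extended by $M_i:(I{\restriction}i)_*\mathcal B_i$ for the equality metavariables $M_i$ of $\Xi$, and the *residual instantiation* of $\Xi$ over it sends $M_i$ to $I(M_i)$ if $M_i$ is an object metavariable and to $\widehat M_i$ otherwise. An instantiation $\langle M_i\mapsto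 e_i\rangle$ over $\Theta;\Gamma$ is *derivable* if $\Theta;\Gamma\vdash((I{\restriction}i)_*\mathcal B_i)[e_i]$ is derivable for all $i$. A derivable rule $\Xi\Longrightarrow\mathcal J$ is *object-invertible* if for all such $\Theta$ and $I$ with $\vdash\Theta\ \mathsf{mctx}$ and $\Theta;[\,]\vdash I_*\mathcal J$ derivable, the residual instantiation is derivable. A derivable finitary rule $\Xi\Longrightarrow A\equiv B$ is a *type computation rule* if $\Xi\Longrightarrow A\ \mathsf{type}$ is deterministic and object-invertible. A derivable finitary rule $\Xi\Longrightarrow u\equiv v:A$ is a *term computation rule* if $u$ is a term symbol application and $\Xi\Longrightarrow u:\tau_{\Xi;[\,]}(u)$ is deterministic and object-invertible. **Proposition.** In a standard type theory: 1. A derivable finitary rule $\Xi\Longrightarrow P\equiv B$ is a type computation rule if $P$ is a type pattern, $\mathrm{mv}(P)=\mathrm{objmv}(\Xi)$, and $\Xi\Longrightarrow P\ \mathsf{type}$ is natural for variables. 2. A derivable finitary rule $\Xi\Longrightarrow p\equiv v:A$ is a term computation rule if $p$ is a term pattern, $\mathrm{mv}(p)=\mathrm{objmv}(\Xi)$, and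 $\Xi\Longrightarrow p:\tau_{\Xi;[\,]}(p)$ is natural for variables. -/

import Mathlib

/-! Finitary type theories: syntax is well scoped and well formed by construction.
Free variables are the positions in a variable context (the `i`-th declared variable is `i`), a
binder in scope `n` binds the variable `n`, and metavariables are the positions in a metavariable
context.  This is the usual syntax up to renaming of variables and metavariables. -/

namespace FTT

universe u v

/-- The two object classes: types and terms. -/
inductive Obj : Type
  | ty
  | tm

/-- The syntactic classes: `obj ty`, `obj tm` are types and terms,
`eq ty`, `eq tm` are type equations and term equations. -/
inductive Cls : Type
  | obj (o : Obj)
  | eq (o : Obj)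

/-- A metavariable arity `(c, m)`: syntactic class and number of arguments (or of binders). -/
structure Arity : Type where
  cls : Cls
  bnd : ℕ

/-- Finite lists of arities, the earliest entry first, extended on the right. -/
inductive Shape : Type
  | nil
  | snoc (μ : Shape) (α : Arity)

/-- `MVar μ α` is the set of positions of `μ` that hold the arity `α`. -/
inductive MVar : Shape → Arity → Type
  | last {μ : Shape} {α : Arity} : MVar (μ.snoc α) α
  | prev {μ : Shape} {α β : Arity} (x : MVar μ α) : MVar (μ.snoc β) α

/-- A signature: the symbols of each object class, and the arities of their arguments. -/
structure Signature : Type (u + 1) where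
  Sym : Obj → Type u
  args : {o : Obj} → Sym o → Shape

/-- `Expr S μ n α`: arguments of arity `α` with metavariables from `μ` and variables from
`0, …, n - 1`.  Those of arity `(obj ty, 0)` are the type expressions, those of arity `(obj tm, 0)`
the term expressions. -/
inductive Expr (S : Signature.{u}) (μ : Shape) : ℕ → Arity → Type u
  | var {n : ℕ} (i : Fin n) : Expr S μ n ⟨.obj .tm, 0⟩
  | sym {n : ℕ} {o : Obj} (s : S.Sym o) (es : ∀ α, MVar (S.args s) α → Expr S μ n α) :
      Expr S μ n ⟨.obj o, 0⟩
  | mv {n : ℕ} {o : Obj} {m : ℕ} (x : MVar μ ⟨.obj o, m⟩)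
      (ts : Fin m → Expr S μ n ⟨.obj .tm, 0⟩) : Expr S μ n ⟨.obj o, 0⟩
  | dummy {n : ℕ} {o : Obj} : Expr S μ n ⟨.eq o, 0⟩
  | abs {n : ℕ} {c : Cls} {m : ℕ} (e : Expr S μ (n + 1) ⟨c, m⟩) : Expr S μ n ⟨c, m + 1⟩

/-- Type expressions. -/
abbrev Ty (S : Signature.{u}) (μ : Shape) (n : ℕ) : Type u := Expr S μ n ⟨.obj .ty, 0⟩

/-- Term expressions. -/
abbrev Tm (S : Signature.{u}) (μ : Shape) (n : ℕ) : Type u := Expr S μ n ⟨.obj .tm, 0⟩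

/-- Instantiations of the metavariables in `μ` by arguments over `ν` and `n` variables. -/
abbrev Inst (S : Signature.{u}) (μ ν : Shape) (n : ℕ) : Type u :=
  ∀ α, MVar μ α → Expr S ν n α

/-- Extend a renaming of variables under a binder. -/
def liftRen {n k : ℕ} (ρ : Fin n → Fin k) : Fin (n + 1) → Fin (k + 1) :=
  Fin.snoc (α := fun _ => Fin (k + 1)) (fun i => (ρ i).castSucc) (Fin.last k)

namespace Expr

variable {S : Signature.{u}} {μ ν : Shape}

/-- Renaming of variables. -/
def rename {n k : ℕ} {α : Arity} (ρ : Fin n → Fin k) : Expr S μ n α → Expr S μ k α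
  | var i => var (ρ i)
  | sym s es => sym s (fun β x => (es β x).rename ρ)
  | mv x ts => mv x (fun j => (ts j).rename ρ)
  | dummy => dummy
  | abs e => abs (e.rename (liftRen ρ))

/-- Weakening by one variable. -/
def weaken {n : ℕ} {α : Arity} (e : Expr S μ n α) : Expr S μ (n + 1) α :=
  e.rename Fin.castSucc

/-- Renaming of metavariables. -/
def renameMv (f : ∀ α, MVar μ α → MVar ν α) {n : ℕ} {α : Arity} :
    Expr S μ n α → Expr S ν n α
  | var i => var i
  | sym s es => sym s (fun β x => (es β x).renameMv f)
  | mv x ts => mv (f _ x) (fun j => (ts j).renameMv f)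
  | dummy => dummy
  | abs e => abs (e.renameMv f)

/-- The substitution `σ, t`. -/
def snocSubst {n k : ℕ} (σ : Fin n → Tm S μ k) (t : Tm S μ k) : Fin (n + 1) → Tm S μ k :=
  Fin.snoc (α := fun _ => Tm S μ k) σ t

/-- Extend a substitution under a binder. -/
def liftSubst {n k : ℕ} (σ : Fin n → Tm S μ k) : Fin (n + 1) → Tm S μ (k + 1) :=
  snocSubst (fun i => (σ i).weaken) (var (Fin.last k))

/-- Simultaneous substitution of terms for variables. -/
def subst {n k : ℕ} {α : Arity} (σ : Fin n → Tm S μ k) : Expr S μ n α → Expr S μ k α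
  | var i => σ i
  | sym s es => sym s (fun β x => (es β x).subst σ)
  | mv x ts => mv x (fun j => (ts j).subst σ)
  | dummy => dummy
  | abs e => abs (e.subst (liftSubst σ))

/-- For `e = {x₁} ⋯ {xₘ} e'`, the expression `e'` with `σ` substituted for the variables of the
scope of `e`, and simultaneously `ts` for `x₁, …, xₘ`. -/
def inst {n k : ℕ} {c : Cls} : {m : ℕ} → Expr S μ n ⟨c, m⟩ → (Fin n → Tm S μ k) →
    (Fin m → Tm S μ k) → Expr S μ k ⟨c, 0⟩
  | 0, e, σ, _ => e.subst σ
  | _ + 1, abs e, σ, ts => e.inst (snocSubst σ (ts 0)) (fun j => ts j.succ)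

/-- `absN m e` is the iterated abstraction `{x₁} ⋯ {xₘ} e` of the last `m` variables. -/
def absN {n : ℕ} {c : Cls} : (m : ℕ) → Expr S μ (n + m) ⟨c, 0⟩ → Expr S μ n ⟨c, m⟩
  | 0, e => e
  | m + 1, e => abs (absN m (e.rename (Fin.cast (by omega))))

/-- The action of an instantiation `I` on an expression; the variables of the scope of the
expression are simultaneously replaced according to `σ` (for the bound variables that we meet on
the way this is the identity). -/
def act {n k : ℕ} {α : Arity} (I : Inst S μ ν n) (σ : Fin k → Tm S ν n) :
    Expr S μ k α → Expr S ν n α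
  | var i => σ i
  | sym s es => sym s (fun β x => (es β x).act I σ)
  | mv x ts => (I _ x).inst var (fun j => (ts j).act I σ)
  | dummy => dummy
  | abs e => abs (e.act (fun β x => (I β x).weaken) (liftSubst σ))

/-- The set of metavariables that occur in an expression. -/
def mvs {n : ℕ} {α : Arity} : Expr S μ n α → Set (Σ β, MVar μ β)
  | var _ => ∅
  | sym _ es => ⋃ β, ⋃ x, (es β x).mvs
  | mv x ts => insert ⟨_, x⟩ (⋃ j, (ts j).mvs)
  | dummy => ∅
  | abs e => e.mvs

end Expr

namespace MVar

variable {S : Signature.{u}}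

/-- The part of `μ` that precedes a position. -/
def before : {μ : Shape} → {α : Arity} → MVar μ α → Shape
  | .snoc μ _, _, last => μ
  | _, _, prev x => x.before

/-- The inclusion of the part of `μ` that precedes the position `x` into `μ`. -/
def embed : {μ : Shape} → {α : Arity} → (x : MVar μ α) → (β : Arity) → MVar x.before β → MVar μ β
  | _, _, last, _, y => prev y
  | _, _, prev x, β, y => prev (x.embed β y)

/-- The application `M(t₁, …, tₘ)`, and the dummy expression for an equality metavariable. -/
def app {μ : Shape} {n m : ℕ} : {c : Cls} → MVar μ ⟨c, m⟩ → (Fin m → Tm S μ n) → Expr S μ n ⟨c, 0⟩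
  | .obj _, x, ts => .mv x ts
  | .eq _, _, _ => .dummy

/-- The generic application: `{x₁} ⋯ {xₘ} M(x₁, …, xₘ)` for an object metavariable `M`, and
`{x₁} ⋯ {xₘ} ⋆` for an equality metavariable. -/
def genapp {μ : Shape} {n : ℕ} : {α : Arity} → MVar μ α → Expr S μ n α
  | ⟨_, m⟩, x => Expr.absN m (x.app (fun j => .var (Fin.natAdd n j)))

end MVar

/-- The set of object metavariables of a metavariable context of shape `μ`. -/
def objMvs (μ : Shape) : Set (Σ β, MVar μ β) := {x | ∃ o, x.1.cls = .obj o}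

/-- Restriction of an instantiation to the metavariables that precede `x`. -/
def Inst.upto {S : Signature.{u}} {μ ν : Shape} {n : ℕ} (I : Inst S μ ν n) {α : Arity}
    (x : MVar μ α) : Inst S x.before ν n :=
  fun β y => I β (x.embed β y)

/-- Abstracted boundaries `{x₁ : A₁} ⋯ {xₘ : Aₘ} B`, indexed by their arity. -/
inductive Bdry (S : Signature.{u}) (μ : Shape) : ℕ → Arity → Type u
  | ty {n : ℕ} : Bdry S μ n ⟨.obj .ty, 0⟩
  | tm {n : ℕ} (A : Ty S μ n) : Bdry S μ n ⟨.obj .tm, 0⟩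
  | eqTy {n : ℕ} (A B : Ty S μ n) : Bdry S μ n ⟨.eq .ty, 0⟩
  | eqTm {n : ℕ} (s t : Tm S μ n) (A : Ty S μ n) : Bdry S μ n ⟨.eq .tm, 0⟩
  | abs {n : ℕ} {c : Cls} {m : ℕ} (A : Ty S μ n) (B : Bdry S μ (n + 1) ⟨c, m⟩) :
      Bdry S μ n ⟨c, m + 1⟩

/-- Abstracted judgements. -/
inductive Judg (S : Signature.{u}) (μ : Shape) : ℕ → Type u
  | isTy {n : ℕ} (A : Ty S μ n) : Judg S μ n
  | hasTy {n : ℕ} (t : Tm S μ n) (A : Ty S μ n) : Judg S μ n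
  | eqTy {n : ℕ} (A B : Ty S μ n) : Judg S μ n
  | eqTm {n : ℕ} (s t : Tm S μ n) (A : Ty S μ n) : Judg S μ n
  | abs {n : ℕ} (A : Ty S μ n) (J : Judg S μ (n + 1)) : Judg S μ n

namespace Bdry

variable {S : Signature.{u}} {μ ν : Shape}

/-- Filling a boundary with a head. -/
def plug {n : ℕ} {α : Arity} : Bdry S μ n α → Expr S μ n α → Judg S μ n
  | ty, A => .isTy A
  | tm A, t => .hasTy t A
  | eqTy A B, _ => .eqTy A B
  | eqTm s t A, _ => .eqTm s t A
  | abs A B, .abs e => .abs A (B.plug e)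

/-- Filling an object boundary with an equation. -/
def plugEq {n m : ℕ} {o : Obj} : Bdry S μ n ⟨.obj o, m⟩ → Expr S μ n ⟨.obj o, m⟩ →
    Expr S μ n ⟨.obj o, m⟩ → Judg S μ n
  | ty, A, B => .eqTy A B
  | tm A, s, t => .eqTm s t A
  | abs A B, .abs e, .abs e' => .abs A (B.plugEq e e')

/-- Renaming of metavariables. -/
def renameMv (f : ∀ α, MVar μ α → MVar ν α) {n : ℕ} {α : Arity} :
    Bdry S μ n α → Bdry S ν n α
  | ty => ty
  | tm A => tm (A.renameMv f)
  | eqTy A B => eqTy (A.renameMv f) (B.renameMv f)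
  | eqTm s t A => eqTm (s.renameMv f) (t.renameMv f) (A.renameMv f)
  | abs A B => abs (A.renameMv f) (B.renameMv f)

/-- Substitution. -/
def subst {n k : ℕ} {α : Arity} (σ : Fin n → Tm S μ k) : Bdry S μ n α → Bdry S μ k α
  | ty => ty
  | tm A => tm (A.subst σ)
  | eqTy A B => eqTy (A.subst σ) (B.subst σ)
  | eqTm s t A => eqTm (s.subst σ) (t.subst σ) (A.subst σ)
  | abs A B => abs (A.subst σ) (B.subst (Expr.liftSubst σ))

/-- The action of an instantiation. -/
def act {n k : ℕ} {α : Arity} (I : Inst S μ ν n) (σ : Fin k → Tm S ν n) :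
    Bdry S μ k α → Bdry S ν n α
  | ty => ty
  | tm A => tm (A.act I σ)
  | eqTy A B => eqTy (A.act I σ) (B.act I σ)
  | eqTm s t A => eqTm (s.act I σ) (t.act I σ) (A.act I σ)
  | abs A B => abs (A.act I σ) (B.act (fun β x => (I β x).weaken) (Expr.liftSubst σ))

/-- For a boundary `{x₁ : A₁} ⋯ {xₘ : Aₘ} B`, the boundary thesis `B[ts/xs]` (with `σ` substituted
for the other variables). -/
def inst {n k : ℕ} {c : Cls} : {m : ℕ} → Bdry S μ n ⟨c, m⟩ → (Fin n → Tm S μ k) →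
    (Fin m → Tm S μ k) → Bdry S μ k ⟨c, 0⟩
  | 0, B, σ, _ => B.subst σ
  | _ + 1, abs _ B, σ, ts => B.inst (Expr.snocSubst σ (ts 0)) (fun j => ts j.succ)

/-- For a boundary `{x₁ : A₁} ⋯ {xₘ : Aₘ} B`, the types `Aⱼ[t₁/x₁, …, tⱼ₋₁/xⱼ₋₁]` (with `σ`
substituted for the other variables). -/
def argTy {n k : ℕ} {c : Cls} : {m : ℕ} → Bdry S μ n ⟨c, m⟩ → (Fin n → Tm S μ k) →
    (Fin m → Tm S μ k) → Fin m → Ty S μ k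
  | 0, _, _, _ => Fin.elim0
  | _ + 1, abs A B, σ, ts =>
      Fin.cases (A.subst σ) (B.argTy (Expr.snocSubst σ (ts 0)) (fun j => ts j.succ))

/-- The equation between the types of two term boundaries; nothing for type boundaries. -/
def tyEqn {n : ℕ} {o : Obj} : Bdry S μ n ⟨.obj o, 0⟩ → Bdry S μ n ⟨.obj o, 0⟩ →
    Option (Judg S μ n)
  | ty, ty => none
  | tm A, tm B => some (.eqTy A B)

/-- The type in a term boundary. -/
def type {n : ℕ} : Bdry S μ n ⟨.obj .tm, 0⟩ → Ty S μ n
  | tm A => A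

end Bdry

/-- The action of an instantiation on a judgement. -/
def Judg.act {S : Signature.{u}} {μ ν : Shape} {n k : ℕ} (I : Inst S μ ν n)
    (σ : Fin k → Tm S ν n) : Judg S μ k → Judg S ν n
  | isTy A => isTy (A.act I σ)
  | hasTy t A => hasTy (t.act I σ) (A.act I σ)
  | eqTy A B => eqTy (A.act I σ) (B.act I σ)
  | eqTm s t A => eqTm (s.act I σ) (t.act I σ) (A.act I σ)
  | abs A J => abs (A.act I σ) (J.act (fun β x => (I β x).weaken) (Expr.liftSubst σ))

/-- Metavariable contexts `[M₁ : B₁, …, Mₙ : Bₙ]`: each boundary is closed and mentions only the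
preceding metavariables. -/
inductive MCtx (S : Signature.{u}) : Shape → Type u
  | nil : MCtx S .nil
  | snoc {μ : Shape} {α : Arity} (Θ : MCtx S μ) (B : Bdry S μ 0 α) : MCtx S (μ.snoc α)

/-- The boundary of a metavariable, over the preceding metavariables. -/
def MCtx.bdry {S : Signature.{u}} : {μ : Shape} → MCtx S μ → {α : Arity} → (x : MVar μ α) →
    Bdry S x.before 0 α
  | _, .snoc _ B, _, .last => B
  | _, .snoc Θ _, _, .prev x => Θ.bdry x

/-- The boundary of a metavariable, over the whole context. -/
def MCtx.lookup {S : Signature.{u}} {μ : Shape} (Θ : MCtx S μ) {α : Arity} (x : MVar μ α) :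
    Bdry S μ 0 α :=
  (Θ.bdry x).renameMv x.embed

/-- Variable contexts `[a₁ : A₁, …, aₙ : Aₙ]`: each type mentions only the preceding variables. -/
inductive Ctx (S : Signature.{u}) (μ : Shape) : ℕ → Type u
  | nil : Ctx S μ 0
  | snoc {n : ℕ} (Γ : Ctx S μ n) (A : Ty S μ n) : Ctx S μ (n + 1)

/-- The type of a variable. -/
def Ctx.lookup {S : Signature.{u}} {μ : Shape} : {n : ℕ} → Ctx S μ n → Fin n → Ty S μ n
  | _, .nil => Fin.elim0
  | _, .snoc Γ A => Fin.lastCases A.weaken (fun i => (Γ.lookup i).weaken)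

/-- A raw rule `Ξ ⟹ B[e]`, where `B` is a boundary thesis. -/
structure RawRule (S : Signature.{u}) : Type u where
  shape : Shape
  prems : MCtx S shape
  cls : Cls
  bdry : Bdry S shape 0 ⟨cls, 0⟩
  head : Expr S shape 0 ⟨cls, 0⟩

/-- The conclusion of a raw rule. -/
def RawRule.concl {S : Signature.{u}} (R : RawRule S) : Judg S R.shape 0 := R.bdry.plug R.head

/-- The rule `Ξ ⟹ A type`. -/
def RawRule.isTy {S : Signature.{u}} {μ : Shape} (Ξ : MCtx S μ) (A : Ty S μ 0) : RawRule S :=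
  ⟨μ, Ξ, .obj .ty, .ty, A⟩

/-- The rule `Ξ ⟹ t : A`. -/
def RawRule.hasTy {S : Signature.{u}} {μ : Shape} (Ξ : MCtx S μ) (t : Tm S μ 0) (A : Ty S μ 0) :
    RawRule S :=
  ⟨μ, Ξ, .obj .tm, .tm A, t⟩

/-- The rule `Ξ ⟹ A ≡ B`. -/
def RawRule.eqTy {S : Signature.{u}} {μ : Shape} (Ξ : MCtx S μ) (A B : Ty S μ 0) : RawRule S :=
  ⟨μ, Ξ, .eq .ty, .eqTy A B, .dummy⟩

/-- The rule `Ξ ⟹ s ≡ t : A`. -/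
def RawRule.eqTm {S : Signature.{u}} {μ : Shape} (Ξ : MCtx S μ) (s t : Tm S μ 0) (A : Ty S μ 0) :
    RawRule S :=
  ⟨μ, Ξ, .eq .tm, .eqTm s t A, .dummy⟩

/-- The symbol rule of the symbol `s` associated with an object rule-boundary `Ξ ⟹ B` whose
symbol arity is that of `s`. -/
def RawRule.symbol {S : Signature.{u}} {o : Obj} (s : S.Sym o) (Ξ : MCtx S (S.args s))
    (B : Bdry S (S.args s) 0 ⟨.obj o, 0⟩) : RawRule S :=
  ⟨S.args s, Ξ, .obj o, B, .sym s (fun _ x => x.genapp)⟩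

/-- A raw type theory: a family of raw rules. -/
structure RawTheory (S : Signature.{u}) : Type (max u (v + 1)) where
  Idx : Type v
  rule : Idx → RawRule S

/-- What a hypothetical judgement or a hypothetical boundary has on the right of `⊢`. -/
inductive Stmt (S : Signature.{u}) (μ : Shape) (n : ℕ) : Type u
  | jdg (J : Judg S μ n)
  | bdry {α : Arity} (B : Bdry S μ n α)

/-- `Der T Θ Γ X`: the hypothetical judgement or boundary `Θ; Γ ⊢ X` is derivable in the deductive
system associated with the raw type theory `T`. -/
inductive Der {S : Signature.{u}} (T : RawTheory.{u, v} S) {μ : Shape} (Θ : MCtx S μ) :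
    {n : ℕ} → Ctx S μ n → Stmt S μ n → Prop
  -- variables, metavariables, abstraction
  | var {n : ℕ} {Γ : Ctx S μ n} (i : Fin n) : Der T Θ Γ (.jdg (.hasTy (.var i) (Γ.lookup i)))
  | mv {n : ℕ} {Γ : Ctx S μ n} {c : Cls} {m : ℕ} (x : MVar μ ⟨c, m⟩) (ts : Fin m → Tm S μ n) :
      (∀ j, Der T Θ Γ (.jdg (.hasTy (ts j) ((Θ.lookup x).argTy Fin.elim0 ts j)))) →
      Der T Θ Γ (.bdry ((Θ.lookup x).inst Fin.elim0 ts)) →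
      Der T Θ Γ (.jdg (((Θ.lookup x).inst Fin.elim0 ts).plug (x.app ts)))
  | mvCongr {n : ℕ} {Γ : Ctx S μ n} {o : Obj} {m : ℕ} (x : MVar μ ⟨.obj o, m⟩)
      (ss ts : Fin m → Tm S μ n) :
      (∀ j, Der T Θ Γ (.jdg (.hasTy (ss j) ((Θ.lookup x).argTy Fin.elim0 ss j)))) →
      (∀ j, Der T Θ Γ (.jdg (.hasTy (ts j) ((Θ.lookup x).argTy Fin.elim0 ts j)))) →
      (∀ j, Der T Θ Γ (.jdg (.eqTm (ss j) (ts j) ((Θ.lookup x).argTy Fin.elim0 ss j)))) →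
      (∀ E ∈ ((Θ.lookup x).inst Fin.elim0 ss).tyEqn ((Θ.lookup x).inst Fin.elim0 ts),
        Der T Θ Γ (.jdg E)) →
      Der T Θ Γ (.jdg (((Θ.lookup x).inst Fin.elim0 ss).plugEq (.mv x ss) (.mv x ts)))
  | abstr {n : ℕ} {Γ : Ctx S μ n} {A : Ty S μ n} {J : Judg S μ (n + 1)} :
      Der T Θ Γ (.jdg (.isTy A)) → Der T Θ (Γ.snoc A) (.jdg J) → Der T Θ Γ (.jdg (.abs A J))
  -- equality
  | tyRefl {n : ℕ} {Γ : Ctx S μ n} {A : Ty S μ n} :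
      Der T Θ Γ (.jdg (.isTy A)) → Der T Θ Γ (.jdg (.eqTy A A))
  | tySym {n : ℕ} {Γ : Ctx S μ n} {A B : Ty S μ n} :
      Der T Θ Γ (.jdg (.eqTy A B)) → Der T Θ Γ (.jdg (.eqTy B A))
  | tyTran {n : ℕ} {Γ : Ctx S μ n} {A B C : Ty S μ n} :
      Der T Θ Γ (.jdg (.eqTy A B)) → Der T Θ Γ (.jdg (.eqTy B C)) →
      Der T Θ Γ (.jdg (.eqTy A C))
  | tmRefl {n : ℕ} {Γ : Ctx S μ n} {t : Tm S μ n} {A : Ty S μ n} :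
      Der T Θ Γ (.jdg (.hasTy t A)) → Der T Θ Γ (.jdg (.eqTm t t A))
  | tmSym {n : ℕ} {Γ : Ctx S μ n} {s t : Tm S μ n} {A : Ty S μ n} :
      Der T Θ Γ (.jdg (.eqTm s t A)) → Der T Θ Γ (.jdg (.eqTm t s A))
  | tmTran {n : ℕ} {Γ : Ctx S μ n} {s t r : Tm S μ n} {A : Ty S μ n} :
      Der T Θ Γ (.jdg (.eqTm s t A)) → Der T Θ Γ (.jdg (.eqTm t r A)) →
      Der T Θ Γ (.jdg (.eqTm s r A))
  | convTm {n : ℕ} {Γ : Ctx S μ n} {t : Tm S μ n} {A B : Ty S μ n} :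
      Der T Θ Γ (.jdg (.hasTy t A)) → Der T Θ Γ (.jdg (.eqTy A B)) →
      Der T Θ Γ (.jdg (.hasTy t B))
  | convEq {n : ℕ} {Γ : Ctx S μ n} {s t : Tm S μ n} {A B : Ty S μ n} :
      Der T Θ Γ (.jdg (.eqTm s t A)) → Der T Θ Γ (.jdg (.eqTy A B)) →
      Der T Θ Γ (.jdg (.eqTm s t B))
  -- boundaries
  | bdryTy {n : ℕ} {Γ : Ctx S μ n} : Der T Θ Γ (.bdry .ty)
  | bdryTm {n : ℕ} {Γ : Ctx S μ n} {A : Ty S μ n} :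
      Der T Θ Γ (.jdg (.isTy A)) → Der T Θ Γ (.bdry (.tm A))
  | bdryEqTy {n : ℕ} {Γ : Ctx S μ n} {A B : Ty S μ n} :
      Der T Θ Γ (.jdg (.isTy A)) → Der T Θ Γ (.jdg (.isTy B)) →
      Der T Θ Γ (.bdry (.eqTy A B))
  | bdryEqTm {n : ℕ} {Γ : Ctx S μ n} {s t : Tm S μ n} {A : Ty S μ n} :
      Der T Θ Γ (.jdg (.isTy A)) → Der T Θ Γ (.jdg (.hasTy s A)) →
      Der T Θ Γ (.jdg (.hasTy t A)) → Der T Θ Γ (.bdry (.eqTm s t A))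
  | bdryAbstr {n : ℕ} {Γ : Ctx S μ n} {c : Cls} {m : ℕ} {A : Ty S μ n}
      {B : Bdry S μ (n + 1) ⟨c, m⟩} :
      Der T Θ Γ (.jdg (.isTy A)) → Der T Θ (Γ.snoc A) (.bdry B) →
      Der T Θ Γ (.bdry (.abs A B))
  -- instantiations of the specific rules
  | specific {n : ℕ} {Γ : Ctx S μ n} (i : T.Idx) (I : Inst S (T.rule i).shape μ n) :
      (∀ α (x : MVar (T.rule i).shape α),
        Der T Θ Γ (.jdg ((((T.rule i).prems.bdry x).act (I.upto x) Fin.elim0).plug (I α x)))) →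
      Der T Θ Γ (.bdry ((T.rule i).bdry.act I Fin.elim0)) →
      Der T Θ Γ (.jdg ((T.rule i).concl.act I Fin.elim0))
  -- congruence rules of the specific object rules
  | congr {n : ℕ} {Γ : Ctx S μ n} (i : T.Idx) {κ : Shape} {Ξ : MCtx S κ} {o : Obj}
      {B : Bdry S κ 0 ⟨.obj o, 0⟩} {e : Expr S κ 0 ⟨.obj o, 0⟩}
      (h : T.rule i = ⟨κ, Ξ, .obj o, B, e⟩) (I J : Inst S κ μ n) :
      (∀ α (x : MVar κ α),
        Der T Θ Γ (.jdg (((Ξ.bdry x).act (I.upto x) Fin.elim0).plug (I α x)))) →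
      (∀ α (x : MVar κ α),
        Der T Θ Γ (.jdg (((Ξ.bdry x).act (J.upto x) Fin.elim0).plug (J α x)))) →
      (∀ (o' : Obj) (m : ℕ) (x : MVar κ ⟨.obj o', m⟩),
        Der T Θ Γ (.jdg (((Ξ.bdry x).act (I.upto x) Fin.elim0).plugEq (I _ x) (J _ x)))) →
      (∀ E ∈ (B.act I Fin.elim0).tyEqn (B.act J Fin.elim0), Der T Θ Γ (.jdg E)) →
      Der T Θ Γ (.jdg ((B.act I Fin.elim0).plugEq (e.act I Fin.elim0) (e.act J Fin.elim0)))

/-- `⊢ Θ mctx`: well-formed metavariable contexts. -/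
inductive MCtx.WF {S : Signature.{u}} (T : RawTheory.{u, v} S) :
    {μ : Shape} → MCtx S μ → Prop
  | nil : WF T .nil
  | snoc {μ : Shape} {α : Arity} {Θ : MCtx S μ} {B : Bdry S μ 0 α} :
      WF T Θ → Der T Θ .nil (.bdry B) → WF T (.snoc Θ B)

/-- The instantiation `I` of `Ξ` over `Θ; Γ` is derivable. -/
def Inst.Derivable {S : Signature.{u}} (T : RawTheory.{u, v} S) {μ ν : Shape} {n : ℕ}
    (Ξ : MCtx S μ) (Θ : MCtx S ν) (Γ : Ctx S ν n) (I : Inst S μ ν n) : Prop :=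
  ∀ α (x : MVar μ α), Der T Θ Γ (.jdg (((Ξ.bdry x).act (I.upto x) Fin.elim0).plug (I α x)))

namespace RawRule

variable {S : Signature.{u}}

/-- Derivable raw rules. -/
def Derivable (T : RawTheory.{u, v} S) (R : RawRule S) : Prop :=
  Der T R.prems .nil (.jdg R.concl)

/-- Finitary raw rules. -/
def Finitary (T : RawTheory.{u, v} S) (R : RawRule S) : Prop :=
  R.prems.WF T ∧ Der T R.prems .nil (.bdry R.bdry)

/-- Deterministic raw rules: every judgement has at most one matching instantiation. -/
def Deterministic (R : RawRule S) : Prop :=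
  ∀ (ν : Shape) (_Θ : MCtx S ν) (n : ℕ) (_Γ : Ctx S ν n) (J : Judg S ν n)
    (I I' : Inst S R.shape ν n),
    R.concl.act I Fin.elim0 = J → R.concl.act I' Fin.elim0 = J → I = I'

/-- `R` is the symbol rule of some rule-boundary for the symbol `s`. -/
def IsSymbolRule (R : RawRule S) {o : Obj} (s : S.Sym o) : Prop :=
  ∃ (Ξ : MCtx S (S.args s)) (B : Bdry S (S.args s) 0 ⟨.obj o, 0⟩), R = symbol s Ξ B

end RawRule

/-- The shape of the equational residue: `ν` extended by the equality metavariables of `μ`. -/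
def Shape.residue (ν : Shape) : Shape → Shape
  | nil => ν
  | snoc μ ⟨.obj _, _⟩ => residue ν μ
  | snoc μ ⟨.eq o, m⟩ => (residue ν μ).snoc ⟨.eq o, m⟩

/-- The inclusion of `ν` into the equational residue. -/
def MVar.toResidue {ν : Shape} : (μ : Shape) → (β : Arity) → MVar ν β → MVar (ν.residue μ) β
  | .nil, _, y => y
  | .snoc μ ⟨.obj _, _⟩, β, y => toResidue μ β y
  | .snoc μ ⟨.eq _, _⟩, β, y => .prev (toResidue μ β y)

/-- The equational residue of an instantiation `I` of `Ξ` over `Θ; []`: the metavariable context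
`Θ` extended by the `I`-instances of the equational premises of `Ξ`. -/
def MCtx.residue {S : Signature.{u}} {ν : Shape} (Θ : MCtx S ν) :
    {μ : Shape} → MCtx S μ → Inst S μ ν 0 → MCtx S (ν.residue μ)
  | _, .nil, _ => Θ
  | .snoc μ ⟨.obj _, _⟩, .snoc Ξ _, I => Θ.residue (μ := μ) Ξ (fun β y => I β y.prev)
  | .snoc μ ⟨.eq _, _⟩, .snoc Ξ B, I =>
      (Θ.residue (μ := μ) Ξ (fun β y => I β y.prev)).snoc
        ((B.act (fun β y => I β y.prev) Fin.elim0).renameMv (MVar.toResidue μ))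

/-- The residual instantiation of `Ξ` over the equational residue and the empty context: it is `I`
on the object metavariables, and generic (that is, `{x₁} ⋯ {xₘ} ⋆`) on equality metavariables. -/
def Inst.residual {S : Signature.{u}} {μ ν : Shape} (I : Inst S μ ν 0) :
    Inst S μ (ν.residue μ) 0
  | ⟨.obj o, m⟩, x => (I ⟨.obj o, m⟩ x).renameMv (MVar.toResidue μ)
  | ⟨.eq _, m⟩, _ => Expr.absN m .dummy

/-- Object-invertible raw rules. -/
def RawRule.ObjInvertible {S : Signature.{u}} (T : RawTheory.{u, v} S) (R : RawRule S) : Prop :=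
  R.Derivable T ∧
  ∀ (ν : Shape) (Θ : MCtx S ν) (I : Inst S R.shape ν 0), Θ.WF T →
    Der T Θ .nil (.jdg (R.concl.act I Fin.elim0)) →
    Inst.Derivable T R.prems (Θ.residue R.prems I) .nil I.residual

/-- A finitary type theory is one whose rules are finitary.  It is standard when its object rules
are symbol rules and each symbol has precisely one rule. -/
structure RawTheory.IsStandard {S : Signature.{u}} (T : RawTheory.{u, v} S) : Prop where
  finitary : ∀ i, (T.rule i).Finitary T
  objRule : ∀ i (o : Obj), (T.rule i).cls = .obj o →
    ∃ (o' : Obj) (s : S.Sym o'), (T.rule i).IsSymbolRule s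
  unique : ∀ (o : Obj) (s : S.Sym o), ∃! i, (T.rule i).IsSymbolRule s

namespace RawTheory.IsStandard

variable {S : Signature.{u}} {T : RawTheory.{u, v} S}

theorem exists_rule (hT : T.IsStandard) {o : Obj} (s : S.Sym o) :
    ∃ (p : MCtx S (S.args s) × Bdry S (S.args s) 0 ⟨.obj o, 0⟩) (i : T.Idx),
      T.rule i = RawRule.symbol s p.1 p.2 := by
  obtain ⟨i, ⟨Ξ, B, h⟩, -⟩ := hT.unique o s
  exact ⟨(Ξ, B), i, h⟩

/-- The conclusion boundary of the symbol rule of `s`. -/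
noncomputable def symBdry (hT : T.IsStandard) {o : Obj} (s : S.Sym o) :
    Bdry S (S.args s) 0 ⟨.obj o, 0⟩ :=
  (hT.exists_rule s).choose.2

/-- The natural type of a term expression. -/
noncomputable def natTy (hT : T.IsStandard) {μ : Shape} (Θ : MCtx S μ) {n : ℕ} (Γ : Ctx S μ n) :
    Tm S μ n → Ty S μ n
  | .var i => Γ.lookup i
  | .mv x ts => ((Θ.lookup x).inst Fin.elim0 ts).type
  | .sym s es => ((hT.symBdry s).act es Fin.elim0).type

end RawTheory.IsStandard

/-- The object judgement `Θ; Γ ⊢ J` is natural for variables. -/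
inductive Natural {S : Signature.{u}} (T : RawTheory.{u, v} S) {μ : Shape} (Θ : MCtx S μ) :
    {n : ℕ} → Ctx S μ n → Judg S μ n → Prop
  | var {n : ℕ} {Γ : Ctx S μ n} (i : Fin n) : Natural T Θ Γ (.hasTy (.var i) (Γ.lookup i))
  | abs {n : ℕ} {Γ : Ctx S μ n} {A : Ty S μ n} {J : Judg S μ (n + 1)} :
      Natural T Θ (Γ.snoc A) J → Natural T Θ Γ (.abs A J)
  | mv {n : ℕ} {Γ : Ctx S μ n} {o : Obj} {m : ℕ} (x : MVar μ ⟨.obj o, m⟩)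
      (ts : Fin m → Tm S μ n) :
      (∀ j, Natural T Θ Γ (.hasTy (ts j) ((Θ.lookup x).argTy Fin.elim0 ts j))) →
      Natural T Θ Γ (((Θ.lookup x).inst Fin.elim0 ts).plug (.mv x ts))
  | sym {n : ℕ} {Γ : Ctx S μ n} {o : Obj} (s : S.Sym o) (i : T.Idx)
      {Ξ : MCtx S (S.args s)} {B : Bdry S (S.args s) 0 ⟨.obj o, 0⟩}
      (h : T.rule i = RawRule.symbol s Ξ B) (es : Inst S (S.args s) μ n)
      (B' : Bdry S μ n ⟨.obj o, 0⟩) :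
      (∀ (o' : Obj) (m : ℕ) (x : MVar (S.args s) ⟨.obj o', m⟩),
        Natural T Θ Γ (((Ξ.bdry x).act (es.upto x) Fin.elim0).plug (es _ x))) →
      Natural T Θ Γ (B'.plug (.sym s es))

/-- The three kinds of patterns. -/
inductive PatKind : Type
  | type
  | term
  | arg

/-- Type patterns, term patterns and argument patterns. -/
inductive IsPattern {S : Signature.{u}} {μ : Shape} {n : ℕ} :
    PatKind → {α : Arity} → Expr S μ n α → Prop
  | typeMv (x : MVar μ ⟨.obj .ty, 0⟩) : IsPattern .type (.mv x Fin.elim0)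
  | typeSym (s : S.Sym .ty) (qs : ∀ α, MVar (S.args s) α → Expr S μ n α) :
      (∀ α (x : MVar (S.args s) α), IsPattern .arg (qs α x)) →
      (∀ x y : (Σ α, MVar (S.args s) α), x ≠ y → Disjoint (qs _ x.2).mvs (qs _ y.2).mvs) →
      IsPattern .type (.sym s qs)
  | termSym (s : S.Sym .tm) (qs : ∀ α, MVar (S.args s) α → Expr S μ n α) :
      (∀ α (x : MVar (S.args s) α), IsPattern .arg (qs α x)) →
      (∀ x y : (Σ α, MVar (S.args s) α), x ≠ y → Disjoint (qs _ x.2).mvs (qs _ y.2).mvs) →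
      IsPattern .term (.sym s qs)
  | argMv {o : Obj} {m : ℕ} (x : MVar μ ⟨.obj o, m⟩) : IsPattern .arg (x.genapp : Expr S μ n _)
  | argDummy {o : Obj} {m : ℕ} (e : Expr S μ n ⟨.eq o, m⟩) : IsPattern .arg e
  | argType {P : Ty S μ n} : IsPattern .type P → IsPattern .arg P
  | argTerm {p : Tm S μ n} : IsPattern .term p → IsPattern .arg p

/-- `Ξ ⟹ A ≡ B` is a type computation rule. -/
def IsTypeCompRule {S : Signature.{u}} (T : RawTheory.{u, v} S) {μ : Shape} (Ξ : MCtx S μ)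
    (A B : Ty S μ 0) : Prop :=
  (RawRule.eqTy Ξ A B).Derivable T ∧ (RawRule.eqTy Ξ A B).Finitary T ∧
    (RawRule.isTy Ξ A).Deterministic ∧ (RawRule.isTy Ξ A).ObjInvertible T

/-- `Ξ ⟹ u ≡ v : A` is a term computation rule. -/
def IsTermCompRule {S : Signature.{u}} {T : RawTheory.{u, v} S} (hT : T.IsStandard) {μ : Shape}
    (Ξ : MCtx S μ) (r w : Tm S μ 0) (A : Ty S μ 0) : Prop :=
  (RawRule.eqTm Ξ r w A).Derivable T ∧ (RawRule.eqTm Ξ r w A).Finitary T ∧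
    (∃ (s : S.Sym .tm) (es : Inst S (S.args s) μ 0), r = .sym s es) ∧
    (RawRule.hasTy Ξ r (hT.natTy Ξ .nil r)).Deterministic ∧
    (RawRule.hasTy Ξ r (hT.natTy Ξ .nil r)).ObjInvertible T

end FTT

/-! Both properties of a computation rule are read off by descending through the pattern to its
leaves, which are generic applications `{x⃗}M(x⃗)`.

Determinism: an instantiation `I` commutes with symbols, and it sends the leaf `{x⃗}M(x⃗)` to `I(M)`
itself (`MVar.genapp_act`). So the instance of the head determines `I` on every metavariable of the
pattern, that is, on all object metavariables (`IsPattern.act_inj`). On an equality metavariable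
there is no choice, since an argument of an equality class is unique.

Object-invertibility: in a standard theory a derivation of a judgement with head `S(e⃗)` ends with
the symbol rule of `S` followed by conversions, so the premises of that rule for `e⃗` are derivable
(`Der.sym_inv`). Repeating this along the pattern reaches a leaf with a derivation of `(I_*
B)[I(M)]`, where `B` is the boundary that the enclosing symbol rule prescribes. What is needed is `B
= Ξ(M)`, and this is where naturality enters: it has no conversion rule, so the type of a variable
or of a metavariable application is fixed syntactically. Opening the binders of `{x⃗}M(x⃗)` then
forces both the types of `x⃗` and the thesis (`Natural.genapp_inv`). Symbol applications carry no
such constraint, because inversion does not depend on their type. This gives all object premises of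
`Ξ` (`IsPattern.der_premise`).

The equality premises are metavariables of the equational residue. The metavariable rule also asks
for their boundaries; these follow along the well-formedness of `Ξ`, because the part of the
residual instantiation already treated is derivable and transports the derivation of the next
boundary (`Inst.residual_derivable`).

The last step needs the admissibility of instantiation, which in turn needs renaming, substitution,
and substitution of equal terms. Renaming, substitution and instantiation are simultaneous actions
of an instantiation and a substitution, so one induction on derivations (`ActionClass.der`) serves
all three. -/

namespace FTT

universe u v

/-! ### Algebra of renaming, substitution and instantiation. -/

section Expressions

variable {S : Signature.{u}} {μ ν ξ : Shape}

/-! ### Renamings and substitutions under binders -/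

@[simp] theorem liftRen_castSucc {n k : ℕ} (ρ : Fin n → Fin k) (i : Fin n) :
    liftRen ρ i.castSucc = (ρ i).castSucc := by simp [liftRen]

@[simp] theorem liftRen_last {n k : ℕ} (ρ : Fin n → Fin k) :
    liftRen ρ (Fin.last n) = Fin.last k := by simp [liftRen]

theorem liftRen_id {n : ℕ} : liftRen (id : Fin n → Fin n) = id := by
  funext i; induction i using Fin.lastCases <;> simp

theorem liftRen_comp {n k l : ℕ} (τ : Fin k → Fin l) (ρ : Fin n → Fin k) :
    liftRen τ ∘ liftRen ρ = liftRen (τ ∘ ρ) := by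
  funext i; induction i using Fin.lastCases <;> simp

theorem liftRen_injective {n k : ℕ} {ρ : Fin n → Fin k} (hρ : Function.Injective ρ) :
    Function.Injective (liftRen ρ) := by
  intro i j h
  induction i using Fin.lastCases <;> induction j using Fin.lastCases <;>
    simp_all [hρ.eq_iff, eq_comm]

namespace Expr

@[simp] theorem snocSubst_castSucc {n k : ℕ} (σ : Fin n → Tm S μ k) (t : Tm S μ k) (i : Fin n) :
    snocSubst σ t i.castSucc = σ i := by simp [snocSubst]

@[simp] theorem snocSubst_last {n k : ℕ} (σ : Fin n → Tm S μ k) (t : Tm S μ k) :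
    snocSubst σ t (Fin.last n) = t := by simp [snocSubst]

@[simp] theorem liftSubst_castSucc {n k : ℕ} (σ : Fin n → Tm S μ k) (i : Fin n) :
    liftSubst σ i.castSucc = (σ i).weaken := by simp [liftSubst]

@[simp] theorem liftSubst_last {n k : ℕ} (σ : Fin n → Tm S μ k) :
    liftSubst σ (Fin.last n) = var (Fin.last k) := by simp [liftSubst]

theorem eq_snocSubst {n k : ℕ} (σ : Fin (n + 1) → Tm S μ k) :
    σ = snocSubst (fun i => σ i.castSucc) (σ (Fin.last n)) := by
  funext i; induction i using Fin.lastCases <;> simp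

theorem rename_id {n : ℕ} {α : Arity} (e : Expr S μ n α) : e.rename id = e := by
  induction e with
  | abs e ih => simp [rename, liftRen_id, ih]
  | _ => simp_all [rename]

theorem rename_rename {n k l : ℕ} {α : Arity} (e : Expr S μ n α) (ρ : Fin n → Fin k)
    (τ : Fin k → Fin l) : (e.rename ρ).rename τ = e.rename (τ ∘ ρ) := by
  induction e generalizing k l with
  | abs e ih => simp [rename, ih, liftRen_comp]
  | _ => simp_all [rename]

/-- Needed to pull an equality of types back from an extended variable context, in
`Natural.bdry_unique`. -/
theorem rename_injective {n k : ℕ} {α : Arity} {ρ : Fin n → Fin k} (hρ : Function.Injective ρ) :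
    Function.Injective (rename (S := S) (μ := μ) (α := α) ρ) := by
  intro e e' h
  induction e generalizing k with
  | var i => cases e' <;> simp_all [rename, hρ.eq_iff]
  | sym s es ih =>
    cases e' with
    | sym s' es' =>
      simp only [rename, sym.injEq] at h
      obtain ⟨rfl, h⟩ := h
      congr 1
      funext β x
      exact ih β x hρ (congrFun (congrFun (eq_of_heq h) β) x)
    | _ => simp [rename] at h
  | mv x ts ih =>
    cases e' with
    | mv x' ts' =>
      simp only [rename, mv.injEq] at h
      obtain ⟨rfl, h, h'⟩ := h
      obtain rfl := eq_of_heq h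
      congr 1
      funext j
      exact ih j hρ (congrFun (eq_of_heq h') j)
    | _ => simp [rename] at h
  | dummy => cases e'; rfl
  | abs e ih =>
    cases e' with
    | abs e' =>
      simp only [rename, abs.injEq] at h
      rw [ih (liftRen_injective hρ) h]

theorem liftSubst_comp_liftRen {n k l : ℕ} (σ : Fin k → Tm S μ l) (ρ : Fin n → Fin k) :
    liftSubst σ ∘ liftRen ρ = liftSubst (σ ∘ ρ) := by
  funext i; induction i using Fin.lastCases <;> simp

theorem liftSubst_var {n : ℕ} : liftSubst (var : Fin n → Tm S μ n) = var := by
  funext i; induction i using Fin.lastCases <;> simp [weaken, rename]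

theorem liftSubst_var_comp {n k : ℕ} (ρ : Fin n → Fin k) :
    liftSubst (fun i => (var (ρ i) : Tm S μ k)) = fun i => var (liftRen ρ i) := by
  funext i; induction i using Fin.lastCases <;> simp [weaken, rename]

theorem weaken_rename_liftRen {n k : ℕ} {α : Arity} (e : Expr S μ n α) (ρ : Fin n → Fin k) :
    e.weaken.rename (liftRen ρ) = (e.rename ρ).weaken := by
  simp only [weaken, rename_rename]
  congr 1; funext i; simp

theorem rename_liftSubst {n k l : ℕ} (σ : Fin n → Tm S μ k) (ρ : Fin k → Fin l) :
    (fun i => (liftSubst σ i).rename (liftRen ρ)) = liftSubst (fun i => (σ i).rename ρ) := by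
  funext i
  induction i using Fin.lastCases <;> simp [weaken_rename_liftRen, rename]

theorem subst_rename {n k l : ℕ} {α : Arity} (e : Expr S μ n α) (ρ : Fin n → Fin k)
    (σ : Fin k → Tm S μ l) : (e.rename ρ).subst σ = e.subst (σ ∘ ρ) := by
  induction e generalizing k l with
  | abs e ih => simp [rename, subst, ih, liftSubst_comp_liftRen]
  | _ => simp_all [rename, subst]

theorem rename_subst {n k l : ℕ} {α : Arity} (e : Expr S μ n α) (σ : Fin n → Tm S μ k)
    (ρ : Fin k → Fin l) : (e.subst σ).rename ρ = e.subst (fun i => (σ i).rename ρ) := by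
  induction e generalizing k l with
  | abs e ih => simp [rename, subst, ih, rename_liftSubst]
  | _ => simp_all [rename, subst]

theorem weaken_subst_liftSubst {n k : ℕ} {α : Arity} (e : Expr S μ n α) (σ : Fin n → Tm S μ k) :
    e.weaken.subst (liftSubst σ) = (e.subst σ).weaken := by
  simp only [weaken, subst_rename, rename_subst]
  congr 1; funext i; simp [weaken]

@[simp] theorem weaken_subst_snocSubst {n k : ℕ} {α : Arity} (e : Expr S μ n α)
    (σ : Fin n → Tm S μ k) (t : Tm S μ k) : e.weaken.subst (snocSubst σ t) = e.subst σ := by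
  simp only [weaken, subst_rename]
  congr 1; funext i; simp

theorem subst_var {n : ℕ} {α : Arity} (e : Expr S μ n α) : e.subst var = e := by
  induction e with
  | abs e ih => simp [subst, liftSubst_var, ih]
  | _ => simp_all [subst]

theorem rename_eq_subst {n k : ℕ} {α : Arity} (e : Expr S μ n α) (ρ : Fin n → Fin k) :
    e.rename ρ = e.subst (fun i => var (ρ i)) := by
  rw [← subst_var (e.rename ρ), subst_rename]; rfl

theorem subst_liftSubst {n k l : ℕ} (σ : Fin n → Tm S μ k) (τ : Fin k → Tm S μ l) :
    (fun i => (liftSubst σ i).subst (liftSubst τ)) = liftSubst (fun i => (σ i).subst τ) := by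
  funext i
  induction i using Fin.lastCases <;> simp [weaken_subst_liftSubst, subst]

theorem subst_subst {n k l : ℕ} {α : Arity} (e : Expr S μ n α) (σ : Fin n → Tm S μ k)
    (τ : Fin k → Tm S μ l) : (e.subst σ).subst τ = e.subst (fun i => (σ i).subst τ) := by
  induction e generalizing k l with
  | abs e ih => simp [subst, ih, subst_liftSubst]
  | _ => simp_all [subst]

/-! ### Instances of abstracted expressions -/

theorem subst_snocSubst {n k l : ℕ} (σ : Fin n → Tm S μ k) (t : Tm S μ k) (τ : Fin k → Tm S μ l) :
    (fun i => (snocSubst σ t i).subst τ) = snocSubst (fun i => (σ i).subst τ) (t.subst τ) := by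
  funext i; induction i using Fin.lastCases <;> simp

theorem liftSubst_subst_snocSubst {n k l : ℕ} (σ : Fin n → Tm S μ k) (τ : Fin k → Tm S μ l)
    (t : Tm S μ l) :
    (fun i => (liftSubst σ i).subst (snocSubst τ t)) = snocSubst (fun i => (σ i).subst τ) t := by
  funext i; induction i using Fin.lastCases <;> simp [subst]

theorem inst_subst {n k l : ℕ} {c : Cls} {m : ℕ} (e : Expr S μ n ⟨c, m⟩) (σ : Fin n → Tm S μ k)
    (ts : Fin m → Tm S μ k) (τ : Fin k → Tm S μ l) :
    (e.inst σ ts).subst τ = e.inst (fun i => (σ i).subst τ) (fun j => (ts j).subst τ) := by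
  induction m generalizing n with
  | zero => simp [inst, subst_subst]
  | succ m ih => cases e with | abs e => simp [inst, ih, subst_snocSubst]

theorem subst_inst {n k l : ℕ} {c : Cls} {m : ℕ} (e : Expr S μ n ⟨c, m⟩) (σ : Fin n → Tm S μ k)
    (τ : Fin k → Tm S μ l) (ts : Fin m → Tm S μ l) :
    (e.subst σ).inst τ ts = e.inst (fun i => (σ i).subst τ) ts := by
  induction m generalizing n k with
  | zero => simp [inst, subst_subst]
  | succ m ih => cases e with | abs e => simp [inst, subst, ih, liftSubst_subst_snocSubst]

theorem inst_rename {n k l : ℕ} {c : Cls} {m : ℕ} (e : Expr S μ n ⟨c, m⟩) (σ : Fin n → Tm S μ k)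
    (ts : Fin m → Tm S μ k) (ρ : Fin k → Fin l) :
    (e.inst σ ts).rename ρ = e.inst (fun i => (σ i).rename ρ) (fun j => (ts j).rename ρ) := by
  simp only [rename_eq_subst, inst_subst]

theorem rename_inst {n k l : ℕ} {c : Cls} {m : ℕ} (e : Expr S μ n ⟨c, m⟩) (ρ : Fin n → Fin k)
    (τ : Fin k → Tm S μ l) (ts : Fin m → Tm S μ l) :
    (e.rename ρ).inst τ ts = e.inst (fun i => τ (ρ i)) ts := by
  simp only [rename_eq_subst, subst_inst, subst]

/-- An abstraction is recovered by applying it to fresh variables. Equations about generic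
applications can therefore be checked on full instances, where the iterated abstraction has
disappeared. -/
theorem inst_ext {n : ℕ} {c : Cls} {m : ℕ} {e e' : Expr S μ n ⟨c, m⟩}
    (h : ∀ (k : ℕ) (σ : Fin n → Tm S μ k) (ts : Fin m → Tm S μ k), e.inst σ ts = e'.inst σ ts) :
    e = e' := by
  induction m generalizing n with
  | zero => simpa [inst, subst_var] using h n var Fin.elim0
  | succ m ih =>
    cases e with | abs e =>
    cases e' with | abs e' =>
    congr 1
    refine ih fun k σ ts => ?_
    -- The variable bound outermost is the last one of the scope of the body, so its value moves
    -- from the end of `σ` to the front of the argument tuple.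
    rw [eq_snocSubst σ]
    exact h k (fun i => σ i.castSucc) (Fin.cons (σ (Fin.last n)) ts)

/-- Expressions of an equality class are unique. -/
instance {n m : ℕ} {o : Obj} : Subsingleton (Expr S μ n ⟨.eq o, m⟩) := by
  refine ⟨fun e e' => ?_⟩
  induction m generalizing n with
  | zero => cases e; cases e'; rfl
  | succ m ih =>
    cases e with | abs e =>
    cases e' with | abs e' =>
    rw [ih e e']

theorem mvs_eq_empty {n m : ℕ} {o : Obj} (e : Expr S μ n ⟨.eq o, m⟩) : e.mvs = ∅ := by
  induction m generalizing n with
  | zero => cases e; rfl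
  | succ m ih => cases e with | abs e => exact ih e

theorem mvs_rename {n k : ℕ} {α : Arity} (e : Expr S μ n α) (ρ : Fin n → Fin k) :
    (e.rename ρ).mvs = e.mvs := by
  induction e generalizing k with
  | _ => simp_all [rename, mvs]

theorem mvs_absN {n : ℕ} {c : Cls} (m : ℕ) (e : Expr S μ (n + m) ⟨c, 0⟩) :
    (absN m e).mvs = e.mvs := by
  induction m generalizing n with
  | zero => rfl
  | succ m ih => simp [absN, mvs, ih, mvs_rename]

/-- The index bookkeeping between `n + (m + 1)` and `(n + 1) + m` is settled here: the first bound
variable is position `n` in both readings. -/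
theorem absN_inst {n k : ℕ} {c : Cls} (m : ℕ) (e : Expr S μ (n + m) ⟨c, 0⟩)
    (σ : Fin n → Tm S μ k) (ts : Fin m → Tm S μ k) :
    (absN m e).inst σ ts = e.subst (Fin.append (α := Tm S μ k) σ ts) := by
  induction m generalizing n with
  | zero =>
    simp only [absN, inst]
    congr 1
    funext i
    exact (Fin.append_left (α := Tm S μ k) σ ts i).symm
  | succ m ih =>
    simp only [absN, inst, ih, subst_rename]
    congr 1
    funext i
    induction i using Fin.addCases with
    | left i =>
      rw [Fin.append_left]
      have : Fin.cast (by omega) (Fin.castAdd (m + 1) i) = Fin.castAdd m i.castSucc := rfl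
      simp [Function.comp, this]
    | right i =>
      rw [Fin.append_right]
      induction i using Fin.cases with
      | zero =>
        have : Fin.cast (by omega) (Fin.natAdd n (0 : Fin (m + 1))) =
          Fin.castAdd m (Fin.last n) := rfl
        simp [Function.comp, this]
      | succ i =>
        have : Fin.cast (by omega) (Fin.natAdd n i.succ) = Fin.natAdd (n + 1) i := by
          ext; simp; omega
        simp [Function.comp, this]

end Expr

namespace MVar

open FTT.Expr

theorem app_subst {n k m : ℕ} {c : Cls} (x : MVar μ ⟨c, m⟩) (ts : Fin m → Tm S μ n)
    (σ : Fin n → Tm S μ k) : (x.app ts).subst σ = x.app (fun j => (ts j).subst σ) := by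
  cases c <;> rfl

@[simp] theorem genapp_inst {n k m : ℕ} {c : Cls} (x : MVar μ ⟨c, m⟩) (σ : Fin n → Tm S μ k)
    (ts : Fin m → Tm S μ k) : (x.genapp : Expr S μ n _).inst σ ts = x.app ts := by
  simp [genapp, absN_inst, app_subst, subst]

@[simp] theorem genapp_subst {n k : ℕ} {α : Arity} (x : MVar μ α) (σ : Fin n → Tm S μ k) :
    (x.genapp : Expr S μ n _).subst σ = x.genapp := by
  obtain ⟨c, m⟩ := α
  refine inst_ext fun l τ ts => ?_
  rw [subst_inst, genapp_inst, genapp_inst]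

@[simp] theorem genapp_rename {n k : ℕ} {α : Arity} (x : MVar μ α) (ρ : Fin n → Fin k) :
    (x.genapp : Expr S μ n _).rename ρ = x.genapp := by
  rw [rename_eq_subst, genapp_subst]

@[simp] theorem genapp_weaken {n : ℕ} {α : Arity} (x : MVar μ α) :
    (x.genapp : Expr S μ n _).weaken = x.genapp := genapp_rename _ _

theorem mvs_genapp {n m : ℕ} {o : Obj} (x : MVar μ ⟨.obj o, m⟩) :
    (x.genapp : Expr S μ n _).mvs = {⟨_, x⟩} := by
  simp [genapp, mvs_absN, app, mvs]

end MVar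

namespace Expr

/-! ### The action of instantiations -/

theorem act_rename {n k l : ℕ} {α : Arity} (e : Expr S μ k α) (ρ : Fin k → Fin l)
    (I : Inst S μ ν n) (σ : Fin l → Tm S ν n) : (e.rename ρ).act I σ = e.act I (σ ∘ ρ) := by
  induction e generalizing n l with
  | abs e ih => simp [rename, act, ih, liftSubst_comp_liftRen]
  | _ => simp_all [rename, act]

theorem rename_act {n k l : ℕ} {α : Arity} (e : Expr S μ k α) (I : Inst S μ ν n)
    (σ : Fin k → Tm S ν n) (ρ : Fin n → Fin l) :
    (e.act I σ).rename ρ = e.act (fun β x => (I β x).rename ρ) (fun i => (σ i).rename ρ) := by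
  induction e generalizing n l with
  | abs e ih => simp [rename, act, ih, rename_liftSubst, weaken_rename_liftRen]
  | mv x ts ih => simp [act, inst_rename, ih, rename_inst, rename]
  | _ => simp_all [rename, act]

@[simp] theorem weaken_act_liftSubst {n k : ℕ} {α : Arity} (e : Expr S μ k α) (I : Inst S μ ν n)
    (σ : Fin k → Tm S ν n) :
    e.weaken.act (fun β x => (I β x).weaken) (liftSubst σ) = (e.act I σ).weaken := by
  simp only [weaken, act_rename, rename_act]
  congr 1; funext i; simp [weaken]

theorem act_liftSubst {n k l : ℕ} (τ : Fin k → Tm S μ l) (I : Inst S μ ν n)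
    (σ : Fin l → Tm S ν n) :
    (fun i => (liftSubst τ i).act (fun β x => (I β x).weaken) (liftSubst σ)) =
      liftSubst (fun i => (τ i).act I σ) := by
  funext i; induction i using Fin.lastCases <;> simp [act]

theorem act_snocSubst {n k l : ℕ} (τ : Fin k → Tm S μ l) (t : Tm S μ l) (I : Inst S μ ν n)
    (σ : Fin l → Tm S ν n) :
    (fun i => (snocSubst τ t i).act I σ) = snocSubst (fun i => (τ i).act I σ) (t.act I σ) := by
  funext i; induction i using Fin.lastCases <;> simp

theorem subst_act {n k l : ℕ} {α : Arity} (e : Expr S μ k α) (I : Inst S μ ν n)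
    (σ : Fin k → Tm S ν n) (τ : Fin n → Tm S ν l) :
    (e.act I σ).subst τ = e.act (fun β x => (I β x).subst τ) (fun i => (σ i).subst τ) := by
  induction e generalizing n l with
  | abs e ih => simp [subst, act, ih, subst_liftSubst, weaken_subst_liftSubst]
  | mv x ts ih => simp [act, inst_subst, ih, subst_inst, subst, subst_var]
  | _ => simp_all [subst, act]

theorem act_subst {n k l : ℕ} {α : Arity} (e : Expr S μ k α) (τ : Fin k → Tm S μ l)
    (I : Inst S μ ν n) (σ : Fin l → Tm S ν n) :
    (e.subst τ).act I σ = e.act I (fun i => (τ i).act I σ) := by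
  induction e generalizing n l with
  | abs e ih => simp [subst, act, ih, act_liftSubst]
  | _ => simp_all [subst, act]

theorem act_inst {n k l m : ℕ} {c : Cls} (e : Expr S μ k ⟨c, m⟩) (τ : Fin k → Tm S μ l)
    (ts : Fin m → Tm S μ l) (I : Inst S μ ν n) (σ : Fin l → Tm S ν n) :
    (e.inst τ ts).act I σ =
      (e.act I (fun i => (τ i).act I σ)).inst var (fun j => (ts j).act I σ) := by
  induction m generalizing k with
  | zero => simp [inst, act_subst, subst_var]
  | succ m ih =>
    cases e with | abs e =>
    simp only [inst, act, ih, act_snocSubst]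
    generalize (fun i => (τ i).act I σ) = τ'
    -- Composing with the identity substitution puts the right side in the form to which
    -- `subst_inst` applies from right to left; `subst_act` then absorbs the new argument into the
    -- action.
    rw [show snocSubst var ((ts 0).act I σ) =
      fun i => (snocSubst var ((ts 0).act I σ) i).subst var by simp [subst_var], ← subst_inst,
      subst_act]
    simp [liftSubst_subst_snocSubst, subst_var]

theorem act_act {n k l : ℕ} {α : Arity} (e : Expr S μ k α) (I : Inst S μ ν n)
    (σ : Fin k → Tm S ν n) (J : Inst S ν ξ l) (τ : Fin n → Tm S ξ l) :
    (e.act I σ).act J τ = e.act (fun β x => (I β x).act J τ) (fun i => (σ i).act J τ) := by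
  induction e generalizing n l with
  | abs e ih => simp [act, ih, act_liftSubst]
  | mv x ts ih => simp [act, act_inst, ih]
  | _ => simp_all [act]

end Expr

@[simp] theorem MVar.app_act {n k m : ℕ} {c : Cls} (x : MVar μ ⟨c, m⟩) (ts : Fin m → Tm S μ k)
    (I : Inst S μ ν n) (σ : Fin k → Tm S ν n) :
    (x.app ts).act I σ = (I _ x).inst .var (fun j => (ts j).act I σ) := by
  cases c
  · rfl
  · exact Subsingleton.elim _ _

@[simp] theorem MVar.genapp_act {n k : ℕ} {α : Arity} (x : MVar μ α) (I : Inst S μ ν n)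
    (σ : Fin k → Tm S ν n) : (x.genapp : Expr S μ k _).act I σ = I α x := by
  obtain ⟨c, m⟩ := α
  refine Expr.inst_ext fun l τ ts => ?_
  -- Open the generic application on the concatenated scope `k + m`, then act by `σ` followed by `τ`
  -- on the first block and by `ts` on the second. `act_inst` computes the result in two ways.
  have h := Expr.act_inst (x.genapp : Expr S μ k _) (fun i => .var (Fin.castAdd m i))
    (fun j => .var (Fin.natAdd k j)) (fun β x => (I β x).subst τ)
    (Fin.append (α := Tm S ν l) (fun i => (σ i).subst τ) ts)
  simp only [genapp_inst, app_act, Expr.act, Fin.append_left, Fin.append_right] at h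
  rw [← Expr.subst_act, Expr.subst_inst, Expr.subst_inst] at h
  simpa [Expr.subst, Expr.subst_var] using h.symm

namespace Expr

/-- The generic instantiation is the identity on metavariables. Substitution, and likewise
`renameMv`, thus become special actions, and the composition law `act_act` for boundaries yields the
mixed laws without further inductions. -/
theorem act_genapp {n k : ℕ} {α : Arity} (e : Expr S μ k α) (σ : Fin k → Tm S μ n) :
    e.act (fun _ x => x.genapp) σ = e.subst σ := by
  induction e generalizing n with
  | abs e ih => simp [act, subst, ih]
  | mv x ts ih => simp [act, subst, ih, MVar.app]
  | _ => simp_all [act, subst]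

theorem act_renameMv {n k : ℕ} {α : Arity} (f : ∀ α, MVar μ α → MVar ν α) (e : Expr S μ k α)
    (I : Inst S ν ξ n) (σ : Fin k → Tm S ξ n) :
    (e.renameMv f).act I σ = e.act (fun β x => I β (f β x)) σ := by
  induction e generalizing n with
  | _ => simp_all [act, renameMv]

theorem renameMv_eq_act {n : ℕ} {α : Arity} (f : ∀ α, MVar μ α → MVar ν α) (e : Expr S μ n α) :
    e.renameMv f = e.act (fun β x => (f β x).genapp) var := by
  rw [← subst_var (e.renameMv f), ← act_genapp, act_renameMv]

end Expr

namespace Bdry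

open FTT.Expr

theorem subst_var {n : ℕ} {α : Arity} (B : Bdry S μ n α) : B.subst var = B := by
  induction B with
  | abs A B ih => simp [subst, Expr.subst_var, liftSubst_var, ih]
  | _ => simp [subst, Expr.subst_var]

theorem act_genapp {n k : ℕ} {α : Arity} (B : Bdry S μ k α) (σ : Fin k → Tm S μ n) :
    B.act (fun _ x => x.genapp) σ = B.subst σ := by
  induction B generalizing n with
  | abs A B ih => simp [act, subst, Expr.act_genapp, ih]
  | _ => simp [act, subst, Expr.act_genapp]

theorem act_renameMv {n k : ℕ} {α : Arity} (f : ∀ α, MVar μ α → MVar ν α) (B : Bdry S μ k α)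
    (I : Inst S ν ξ n) (σ : Fin k → Tm S ξ n) :
    (B.renameMv f).act I σ = B.act (fun β x => I β (f β x)) σ := by
  induction B generalizing n with
  | abs A B ih => simp [act, renameMv, Expr.act_renameMv, ih]
  | _ => simp [act, renameMv, Expr.act_renameMv]

theorem renameMv_eq_act {n : ℕ} {α : Arity} (f : ∀ α, MVar μ α → MVar ν α) (B : Bdry S μ n α) :
    B.renameMv f = B.act (fun β x => (f β x).genapp) var := by
  rw [← subst_var (B.renameMv f), ← act_genapp, act_renameMv]

theorem act_act {n k l : ℕ} {α : Arity} (B : Bdry S μ k α) (I : Inst S μ ν n)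
    (σ : Fin k → Tm S ν n) (J : Inst S ν ξ l) (τ : Fin n → Tm S ξ l) :
    (B.act I σ).act J τ = B.act (fun β x => (I β x).act J τ) (fun i => (σ i).act J τ) := by
  induction B generalizing n l with
  | abs A B ih => simp [act, ih, act_liftSubst, Expr.act_act]
  | _ => simp [act, Expr.act_act]

theorem act_subst {n k l : ℕ} {α : Arity} (B : Bdry S μ k α) (τ : Fin k → Tm S μ l)
    (I : Inst S μ ν n) (σ : Fin l → Tm S ν n) :
    (B.subst τ).act I σ = B.act I (fun i => (τ i).act I σ) := by
  simp [← act_genapp, act_act]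

theorem subst_act {n k l : ℕ} {α : Arity} (B : Bdry S μ k α) (I : Inst S μ ν n)
    (σ : Fin k → Tm S ν n) (τ : Fin n → Tm S ν l) :
    (B.act I σ).subst τ = B.act (fun β x => (I β x).subst τ) (fun i => (σ i).subst τ) := by
  simp [← act_genapp, act_act, ← Expr.act_genapp]

theorem subst_subst {n k l : ℕ} {α : Arity} (B : Bdry S μ n α) (σ : Fin n → Tm S μ k)
    (τ : Fin k → Tm S μ l) : (B.subst σ).subst τ = B.subst (fun i => (σ i).subst τ) := by
  simp [← act_genapp, act_act, ← Expr.act_genapp]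

theorem renameMv_renameMv {n : ℕ} {α : Arity} (f : ∀ α, MVar μ α → MVar ν α)
    (g : ∀ α, MVar ν α → MVar ξ α) (B : Bdry S μ n α) :
    (B.renameMv f).renameMv g = B.renameMv (fun β x => g β (f β x)) := by
  simp [renameMv_eq_act, act_act, Expr.act]

theorem subst_inst {n k l m : ℕ} {c : Cls} (B : Bdry S μ n ⟨c, m⟩) (σ : Fin n → Tm S μ k)
    (τ : Fin k → Tm S μ l) (ts : Fin m → Tm S μ l) :
    (B.subst σ).inst τ ts = B.inst (fun i => (σ i).subst τ) ts := by
  induction m generalizing n k with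
  | zero => simp [inst, subst_subst]
  | succ m ih => cases B with | abs A B => simp [inst, subst, ih, liftSubst_subst_snocSubst]

theorem subst_argTy {n k l m : ℕ} {c : Cls} (B : Bdry S μ n ⟨c, m⟩) (σ : Fin n → Tm S μ k)
    (τ : Fin k → Tm S μ l) (ts : Fin m → Tm S μ l) :
    (B.subst σ).argTy τ ts = B.argTy (fun i => (σ i).subst τ) ts := by
  induction m generalizing n k with
  | zero => funext j; exact j.elim0
  | succ m ih =>
    cases B with | abs A B =>
    simp [argTy, subst, ih, liftSubst_subst_snocSubst, Expr.subst_subst]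

theorem snocSubst_var_eq {n : ℕ} (t : Tm S μ n) :
    snocSubst var t = fun i => (snocSubst var t i).subst var := by simp [Expr.subst_var]

theorem act_inst {n k l m : ℕ} {c : Cls} (B : Bdry S μ k ⟨c, m⟩) (τ : Fin k → Tm S μ l)
    (ts : Fin m → Tm S μ l) (I : Inst S μ ν n) (σ : Fin l → Tm S ν n) :
    (B.inst τ ts).act I σ =
      (B.act I (fun i => (τ i).act I σ)).inst var (fun j => (ts j).act I σ) := by
  induction m generalizing k with
  | zero => simp [inst, act_subst, subst_var]
  | succ m ih =>
    cases B with | abs A B =>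
    simp only [inst, act, ih, act_snocSubst]
    rw [snocSubst_var_eq, ← subst_inst, subst_act]
    simp [liftSubst_subst_snocSubst, Expr.subst_var]

theorem act_argTy {n k l m : ℕ} {c : Cls} (B : Bdry S μ k ⟨c, m⟩) (τ : Fin k → Tm S μ l)
    (ts : Fin m → Tm S μ l) (I : Inst S μ ν n) (σ : Fin l → Tm S ν n) (j : Fin m) :
    (B.argTy τ ts j).act I σ =
      (B.act I (fun i => (τ i).act I σ)).argTy var (fun j => (ts j).act I σ) j := by
  induction m generalizing k with
  | zero => exact j.elim0
  | succ m ih =>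
    cases B with | abs A B =>
    induction j using Fin.cases with
    | zero => simp [argTy, act, Expr.act_subst, Expr.subst_var]
    | succ j =>
      simp only [argTy, act, Fin.cases_succ, ih, act_snocSubst]
      rw [snocSubst_var_eq, ← subst_argTy, subst_act]
      simp [liftSubst_subst_snocSubst, Expr.subst_var]

end Bdry

/-- The action of an instantiation on a hypothetical judgement or boundary. -/
def Stmt.act {n k : ℕ} (I : Inst S μ ν n) (σ : Fin k → Tm S ν n) : Stmt S μ k → Stmt S ν n
  | .jdg J => .jdg (J.act I σ)
  | .bdry B => .bdry (B.act I σ)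

theorem Bdry.plug_act {n k : ℕ} {α : Arity} (B : Bdry S μ k α) (e : Expr S μ k α)
    (I : Inst S μ ν n) (σ : Fin k → Tm S ν n) :
    (B.plug e).act I σ = (B.act I σ).plug (e.act I σ) := by
  induction B generalizing n with
  | abs A B ih =>
    cases e with | abs e =>
    simp [plug, act, Judg.act, Expr.act, ih]
  | _ => rfl

theorem Bdry.plugEq_act {n k m : ℕ} {o : Obj} (B : Bdry S μ k ⟨.obj o, m⟩)
    (e e' : Expr S μ k ⟨.obj o, m⟩) (I : Inst S μ ν n) (σ : Fin k → Tm S ν n) :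
    (B.plugEq e e').act I σ = (B.act I σ).plugEq (e.act I σ) (e'.act I σ) := by
  induction m generalizing n k with
  | zero => cases B <;> rfl
  | succ m ih =>
    cases B with | abs A B =>
    cases e with | abs e =>
    cases e' with | abs e' =>
    simp [plugEq, act, Judg.act, Expr.act, ih]

theorem Judg.act_act {n k l : ℕ} (J : Judg S μ k) (I : Inst S μ ν n)
    (σ : Fin k → Tm S ν n) (I' : Inst S ν ξ l) (τ : Fin n → Tm S ξ l) :
    (J.act I σ).act I' τ = J.act (fun β x => (I β x).act I' τ) (fun i => (σ i).act I' τ) := by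
  induction J generalizing n l with
  | abs A J ih => simp [act, ih, Expr.act_liftSubst, Expr.act_act]
  | _ => simp [act, Expr.act_act]

theorem Bdry.tyEqn_act {n k : ℕ} {o : Obj} (B C : Bdry S μ k ⟨.obj o, 0⟩) (I : Inst S μ ν n)
    (σ : Fin k → Tm S ν n) :
    (B.act I σ).tyEqn (C.act I σ) = (B.tyEqn C).map (Judg.act I σ) := by
  cases B <;> cases C <;> rfl

end Expressions

/-! ### Admissibility of renaming, substitution, equal substitution and instantiation. -/

section Metatheory

variable {S : Signature.{u}} {T : RawTheory.{u, v} S} {μ ν : Shape}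

/-- For a closed boundary the composed substitution is a map out of `Fin 0`; it is brought back to
the normal form `Fin.elim0` in which the rules of `Der` are written. -/
theorem Bdry.act_inst_closed {n l m : ℕ} {c : Cls} (L : Bdry S μ 0 ⟨c, m⟩)
    (ts : Fin m → Tm S μ l) (I : Inst S μ ν n) (σ : Fin l → Tm S ν n) :
    (L.inst Fin.elim0 ts).act I σ =
      (L.act I Fin.elim0).inst .var (fun j => (ts j).act I σ) := by
  rw [act_inst, Subsingleton.elim (fun i : Fin 0 => _) Fin.elim0]

theorem Bdry.act_argTy_closed {n l m : ℕ} {c : Cls} (L : Bdry S μ 0 ⟨c, m⟩)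
    (ts : Fin m → Tm S μ l) (I : Inst S μ ν n) (σ : Fin l → Tm S ν n) (j : Fin m) :
    (L.argTy Fin.elim0 ts j).act I σ =
      (L.act I Fin.elim0).argTy .var (fun j => (ts j).act I σ) j := by
  rw [act_argTy, Subsingleton.elim (fun i : Fin 0 => _) Fin.elim0]

theorem Bdry.act_act_closed {n l : ℕ} {ξ : Shape} {α : Arity} (L : Bdry S μ 0 α)
    (I : Inst S μ ν n) (J : Inst S ν ξ l) (τ : Fin n → Tm S ξ l) :
    (L.act I Fin.elim0).act J τ = L.act (fun β x => (I β x).act J τ) Fin.elim0 := by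
  rw [act_act, Subsingleton.elim (fun i : Fin 0 => _) Fin.elim0]

theorem Judg.act_act_closed {n l : ℕ} {ξ : Shape} (L : Judg S μ 0)
    (I : Inst S μ ν n) (J : Inst S ν ξ l) (τ : Fin n → Tm S ξ l) :
    (L.act I Fin.elim0).act J τ = L.act (fun β x => (I β x).act J τ) Fin.elim0 := by
  rw [act_act, Subsingleton.elim (fun i : Fin 0 => _) Fin.elim0]

theorem Expr.act_act_closed {n l : ℕ} {ξ : Shape} {α : Arity} (L : Expr S μ 0 α)
    (I : Inst S μ ν n) (J : Inst S ν ξ l) (τ : Fin n → Tm S ξ l) :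
    (L.act I Fin.elim0).act J τ = L.act (fun β x => (I β x).act J τ) Fin.elim0 := by
  rw [act_act, Subsingleton.elim (fun i : Fin 0 => _) Fin.elim0]

theorem MCtx.lookup_act {n : ℕ} (Ξ : MCtx S μ) {α : Arity} (x : MVar μ α) (I : Inst S μ ν n)
    (σ : Fin 0 → Tm S ν n) : (Ξ.lookup x).act I σ = (Ξ.bdry x).act (I.upto x) σ :=
  Bdry.act_renameMv _ _ _ _

theorem Inst.upto_act {n k : ℕ} {ξ : Shape} {α : Arity} (x : MVar μ α) (J : Inst S μ ν n)
    (I : Inst S ν ξ k) (σ : Fin n → Tm S ξ k) :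
    (fun β y => (J.upto x β y).act I σ) = Inst.upto (fun β y => (J β y).act I σ) x := rfl

/-- A class of actions `I, σ` from `Ξ; Γ` to `Θ; Δ` that preserves derivability. -/
structure ActionClass (T : RawTheory.{u, v} S) (Ξ : MCtx S μ) (Θ : MCtx S ν)
    (Q : ∀ {n k : ℕ}, Ctx S μ n → Ctx S ν k → Inst S μ ν k → (Fin n → Tm S ν k) → Prop) :
    Prop where
  lift : ∀ {n k : ℕ} {Γ : Ctx S μ n} {Δ : Ctx S ν k} {I : Inst S μ ν k} {σ : Fin n → Tm S ν k}
    (A : Ty S μ n), Q Γ Δ I σ →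
    Q (Γ.snoc A) (Δ.snoc (A.act I σ)) (fun β x => (I β x).weaken) (Expr.liftSubst σ)
  var : ∀ {n k : ℕ} {Γ : Ctx S μ n} {Δ : Ctx S ν k} {I : Inst S μ ν k} {σ : Fin n → Tm S ν k},
    Q Γ Δ I σ → ∀ i, Der T Θ Δ (.jdg (.hasTy (σ i) ((Γ.lookup i).act I σ)))
  mv : ∀ {n k : ℕ} {Γ : Ctx S μ n} {Δ : Ctx S ν k} {I : Inst S μ ν k} {σ : Fin n → Tm S ν k},
    Q Γ Δ I σ → ∀ {c : Cls} {m : ℕ} (x : MVar μ ⟨c, m⟩) (ts : Fin m → Tm S ν k),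
    (∀ j, Der T Θ Δ (.jdg (.hasTy (ts j) (((Ξ.lookup x).act I Fin.elim0).argTy .var ts j)))) →
    Der T Θ Δ (.bdry (((Ξ.lookup x).act I Fin.elim0).inst .var ts)) →
    Der T Θ Δ (.jdg ((((Ξ.lookup x).act I Fin.elim0).inst .var ts).plug ((I _ x).inst .var ts)))
  mvCongr : ∀ {n k : ℕ} {Γ : Ctx S μ n} {Δ : Ctx S ν k} {I : Inst S μ ν k}
    {σ : Fin n → Tm S ν k},
    Q Γ Δ I σ → ∀ {o : Obj} {m : ℕ} (x : MVar μ ⟨.obj o, m⟩) (ss ts : Fin m → Tm S ν k),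
    (∀ j, Der T Θ Δ (.jdg (.hasTy (ss j) (((Ξ.lookup x).act I Fin.elim0).argTy .var ss j)))) →
    (∀ j, Der T Θ Δ (.jdg (.hasTy (ts j) (((Ξ.lookup x).act I Fin.elim0).argTy .var ts j)))) →
    (∀ j, Der T Θ Δ (.jdg (.eqTm (ss j) (ts j)
      (((Ξ.lookup x).act I Fin.elim0).argTy .var ss j)))) →
    (∀ E ∈ (((Ξ.lookup x).act I Fin.elim0).inst .var ss).tyEqn
      (((Ξ.lookup x).act I Fin.elim0).inst .var ts), Der T Θ Δ (.jdg E)) →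
    Der T Θ Δ (.jdg ((((Ξ.lookup x).act I Fin.elim0).inst .var ss).plugEq
      ((I _ x).inst .var ss) ((I _ x).inst .var ts)))

/-- The rules other than variables, metavariables and metavariable congruence have premises and
conclusions that commute with actions, given closure of the class under binders. Those three rules
are the remaining fields of `ActionClass`. -/
theorem ActionClass.der {Ξ : MCtx S μ} {Θ : MCtx S ν}
    {Q : ∀ {n k : ℕ}, Ctx S μ n → Ctx S ν k → Inst S μ ν k → (Fin n → Tm S ν k) → Prop}
    (hQ : ActionClass T Ξ Θ Q) {n k : ℕ} {Γ : Ctx S μ n} {Δ : Ctx S ν k} {I : Inst S μ ν k}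
    {σ : Fin n → Tm S ν k} {X : Stmt S μ n} (hX : Der T Ξ Γ X) (h : Q Γ Δ I σ) :
    Der T Θ Δ (X.act I σ) := by
  induction hX generalizing k with
  | var i => exact hQ.var h i
  | mv x ts _ _ ih ihB =>
    have := hQ.mv h x (fun j => (ts j).act I σ)
      (fun j => by simpa [Stmt.act, Judg.act, Bdry.act_argTy_closed] using ih j h)
      (by simpa [Stmt.act, Bdry.act_inst_closed] using ihB h)
    simpa [Stmt.act, Bdry.plug_act, Bdry.act_inst_closed] using this
  | mvCongr x ss ts _ _ _ _ ihs iht ihe ihB =>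
    have := hQ.mvCongr h x (fun j => (ss j).act I σ) (fun j => (ts j).act I σ)
      (fun j => by simpa [Stmt.act, Judg.act, Bdry.act_argTy_closed] using ihs j h)
      (fun j => by simpa [Stmt.act, Judg.act, Bdry.act_argTy_closed] using iht j h)
      (fun j => by simpa [Stmt.act, Judg.act, Bdry.act_argTy_closed] using ihe j h)
      (fun E hE => by
        rw [← Bdry.act_inst_closed (σ := σ), ← Bdry.act_inst_closed (σ := σ), Bdry.tyEqn_act,
          Option.mem_map] at hE
        obtain ⟨E, hE, rfl⟩ := hE
        exact ihB E hE h)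
    simpa [Stmt.act, Bdry.plugEq_act, Bdry.act_inst_closed, Expr.act] using this
  | abstr _ _ ihA ihJ => exact .abstr (ihA h) (ihJ (hQ.lift _ h))
  | tyRefl _ ih => exact .tyRefl (ih h)
  | tySym _ ih => exact .tySym (ih h)
  | tyTran _ _ ih ih' => exact .tyTran (ih h) (ih' h)
  | tmRefl _ ih => exact .tmRefl (ih h)
  | tmSym _ ih => exact .tmSym (ih h)
  | tmTran _ _ ih ih' => exact .tmTran (ih h) (ih' h)
  | convTm _ _ ih ih' => exact .convTm (ih h) (ih' h)
  | convEq _ _ ih ih' => exact .convEq (ih h) (ih' h)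
  | bdryTy => exact .bdryTy
  | bdryTm _ ih => exact .bdryTm (ih h)
  | bdryEqTy _ _ ih ih' => exact .bdryEqTy (ih h) (ih' h)
  | bdryEqTm _ _ _ ih ih' ih'' => exact .bdryEqTm (ih h) (ih' h) (ih'' h)
  | bdryAbstr _ _ ihA ihB => exact .bdryAbstr (ihA h) (ihB (hQ.lift _ h))
  | specific i J _ _ ih ihB =>
    have := Der.specific i (fun β x => (J β x).act I σ)
      (fun α x => by
        simpa [Stmt.act, Bdry.plug_act, Bdry.act_act_closed, Inst.upto_act] using ih α x h)
      (by simpa [Stmt.act, Bdry.act_act_closed] using ihB h)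
    simpa [Stmt.act, Judg.act_act_closed] using this
  | @congr n Γ i κ Ξ' o B e hR J J' _ _ _ _ ih ih' ihe ihB =>
    have := Der.congr i hR (fun β x => (J β x).act I σ) (fun β x => (J' β x).act I σ)
      (fun α x => by
        simpa [Stmt.act, Bdry.plug_act, Bdry.act_act_closed, Inst.upto_act] using ih α x h)
      (fun α x => by
        simpa [Stmt.act, Bdry.plug_act, Bdry.act_act_closed, Inst.upto_act] using ih' α x h)
      (fun o m x => by
        simpa [Stmt.act, Bdry.plugEq_act, Bdry.act_act_closed, Inst.upto_act] using ihe o m x h)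
      (fun E hE => by
        rw [← Bdry.act_act_closed, ← Bdry.act_act_closed, Bdry.tyEqn_act, Option.mem_map] at hE
        obtain ⟨E, hE, rfl⟩ := hE
        exact ihB E hE h)
    simpa [Stmt.act, Bdry.plugEq_act, Bdry.act_act_closed, Expr.act_act_closed] using this

/-! ### Renaming and substitution -/

theorem Bdry.lookup_act_genapp {Ξ : MCtx S μ} {Θ : MCtx S ν} {f : ∀ α, MVar μ α → MVar ν α}
    (hf : ∀ α (x : MVar μ α), Θ.lookup (f α x) = (Ξ.lookup x).renameMv f) {k : ℕ} {α : Arity}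
    (x : MVar μ α) (σ : Fin 0 → Tm S ν k) :
    (Ξ.lookup x).act (fun β y => (f β y).genapp) σ = (Θ.lookup (f α x)).subst σ := by
  rw [hf, ← act_genapp, act_renameMv]

theorem Der.mv_subst {Θ : MCtx S ν} {k : ℕ} {Δ : Ctx S ν k} {c : Cls} {m : ℕ}
    (x : MVar ν ⟨c, m⟩) (ts : Fin m → Tm S ν k)
    (h : ∀ j, Der T Θ Δ (.jdg (.hasTy (ts j) (((Θ.lookup x).subst Fin.elim0).argTy .var ts j))))
    (hB : Der T Θ Δ (.bdry (((Θ.lookup x).subst Fin.elim0).inst .var ts))) :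
    Der T Θ Δ (.jdg ((((Θ.lookup x).subst Fin.elim0).inst .var ts).plug (x.app ts))) := by
  rw [Bdry.subst_inst, Subsingleton.elim (fun i : Fin 0 => _) Fin.elim0] at hB ⊢
  rw [Bdry.subst_argTy, Subsingleton.elim (fun i : Fin 0 => _) Fin.elim0] at h
  exact .mv x ts h hB

theorem Der.mvCongr_subst {Θ : MCtx S ν} {k : ℕ} {Δ : Ctx S ν k} {o : Obj} {m : ℕ}
    (x : MVar ν ⟨.obj o, m⟩) (ss ts : Fin m → Tm S ν k)
    (hs : ∀ j, Der T Θ Δ (.jdg (.hasTy (ss j) (((Θ.lookup x).subst Fin.elim0).argTy .var ss j))))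
    (ht : ∀ j, Der T Θ Δ (.jdg (.hasTy (ts j) (((Θ.lookup x).subst Fin.elim0).argTy .var ts j))))
    (he : ∀ j, Der T Θ Δ (.jdg (.eqTm (ss j) (ts j)
      (((Θ.lookup x).subst Fin.elim0).argTy .var ss j))))
    (hB : ∀ E ∈ (((Θ.lookup x).subst Fin.elim0).inst .var ss).tyEqn
      (((Θ.lookup x).subst Fin.elim0).inst .var ts), Der T Θ Δ (.jdg E)) :
    Der T Θ Δ (.jdg ((((Θ.lookup x).subst Fin.elim0).inst .var ss).plugEq
      (x.app ss) (x.app ts))) := by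
  simp only [Bdry.subst_inst, Bdry.subst_argTy,
    Subsingleton.elim (fun i : Fin 0 => Expr.subst _ (Fin.elim0 i)) Fin.elim0] at *
  exact .mvCongr x ss ts hs ht he hB

@[simp] theorem Ctx.lookup_last {n : ℕ} (Γ : Ctx S μ n) (A : Ty S μ n) :
    (Γ.snoc A).lookup (Fin.last n) = A.weaken := by simp [lookup]

@[simp] theorem Ctx.lookup_castSucc {n : ℕ} (Γ : Ctx S μ n) (A : Ty S μ n) (i : Fin n) :
    (Γ.snoc A).lookup i.castSucc = (Γ.lookup i).weaken := by simp [lookup]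

/-- Renames variables and metavariables together. It has to precede substitution, since moving a
typed substitution under a binder requires weakening its terms. -/
theorem actionClass_renaming {Ξ : MCtx S μ} {Θ : MCtx S ν} (f : ∀ α, MVar μ α → MVar ν α)
    (hf : ∀ α (x : MVar μ α), Θ.lookup (f α x) = (Ξ.lookup x).renameMv f) :
    ActionClass T Ξ Θ (fun {n k} Γ Δ I σ => ∃ ρ : Fin n → Fin k, I = (fun β x => (f β x).genapp) ∧
      σ = (fun i => .var (ρ i)) ∧ ∀ i, Δ.lookup (ρ i) = (Γ.lookup i).act I σ) where
  lift := by
    rintro n k Γ Δ I σ A ⟨ρ, rfl, rfl, h⟩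
    refine ⟨liftRen ρ, by simp, Expr.liftSubst_var_comp ρ, fun i => ?_⟩
    induction i using Fin.lastCases with
    | last => rw [liftRen_last, Ctx.lookup_last, Ctx.lookup_last, Expr.weaken_act_liftSubst]
    | cast i =>
      rw [liftRen_castSucc, Ctx.lookup_castSucc, Ctx.lookup_castSucc, Expr.weaken_act_liftSubst, h]
  var := by
    rintro n k Γ Δ I σ ⟨ρ, rfl, rfl, h⟩ i
    rw [← h]
    exact .var _
  mv := by
    rintro n k Γ Δ I σ ⟨ρ, rfl, rfl, h⟩ c m x ts
    rw [Bdry.lookup_act_genapp hf, MVar.genapp_inst]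
    exact Der.mv_subst _ _
  mvCongr := by
    rintro n k Γ Δ I σ ⟨ρ, rfl, rfl, h⟩ o m x ss ts
    rw [Bdry.lookup_act_genapp hf, MVar.genapp_inst, MVar.genapp_inst]
    exact Der.mvCongr_subst _ _ _

theorem Bdry.renameMv_id {n : ℕ} {α : Arity} (B : Bdry S μ n α) :
    B.renameMv (fun _ x => x) = B := by
  rw [renameMv_eq_act, act_genapp, subst_var]

theorem Der.weaken {Θ : MCtx S μ} {n : ℕ} {Γ : Ctx S μ n} {X : Stmt S μ n} (h : Der T Θ Γ X)
    (A : Ty S μ n) :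
    Der T Θ (Γ.snoc A) (X.act (fun _ x => x.genapp) (fun i => .var i.castSucc)) :=
  (actionClass_renaming (fun _ x => x) fun _ _ => (Bdry.renameMv_id _).symm).der h
    ⟨Fin.castSucc, rfl, rfl, fun i => by
      rw [Ctx.lookup_castSucc, Expr.act_genapp, Expr.weaken, Expr.rename_eq_subst]⟩

theorem Expr.act_genapp_castSucc {n : ℕ} {α : Arity} (e : Expr S μ n α) :
    e.act (fun _ x => x.genapp) (fun i => .var i.castSucc) = e.weaken := by
  rw [act_genapp, weaken, rename_eq_subst]

theorem Der.weaken_hasTy {Θ : MCtx S μ} {n : ℕ} {Γ : Ctx S μ n} {t : Tm S μ n} {B : Ty S μ n}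
    (h : Der T Θ Γ (.jdg (.hasTy t B))) (A : Ty S μ n) :
    Der T Θ (Γ.snoc A) (.jdg (.hasTy t.weaken B.weaken)) := by
  simpa [Stmt.act, Judg.act, Expr.act_genapp_castSucc] using h.weaken A

theorem Der.weaken_eqTm {Θ : MCtx S μ} {n : ℕ} {Γ : Ctx S μ n} {s t : Tm S μ n} {B : Ty S μ n}
    (h : Der T Θ Γ (.jdg (.eqTm s t B))) (A : Ty S μ n) :
    Der T Θ (Γ.snoc A) (.jdg (.eqTm s.weaken t.weaken B.weaken)) := by
  simpa [Stmt.act, Judg.act, Expr.act_genapp_castSucc] using h.weaken A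

theorem Der.weaken_eqTy {Θ : MCtx S μ} {n : ℕ} {Γ : Ctx S μ n} {B C : Ty S μ n}
    (h : Der T Θ Γ (.jdg (.eqTy B C))) (A : Ty S μ n) :
    Der T Θ (Γ.snoc A) (.jdg (.eqTy B.weaken C.weaken)) := by
  simpa [Stmt.act, Judg.act, Expr.act_genapp_castSucc] using h.weaken A

/-- The substitution `σ` from `Γ` to `Δ` is well typed. -/
def TypedSubst (T : RawTheory.{u, v} S) (Θ : MCtx S μ) {n k : ℕ} (Γ : Ctx S μ n) (Δ : Ctx S μ k)
    (σ : Fin n → Tm S μ k) : Prop :=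
  ∀ i, Der T Θ Δ (.jdg (.hasTy (σ i) ((Γ.lookup i).subst σ)))

theorem TypedSubst.var {Θ : MCtx S μ} {n : ℕ} (Γ : Ctx S μ n) :
    TypedSubst T Θ Γ Γ .var := fun i => by
  rw [Expr.subst_var]
  exact .var i

theorem TypedSubst.lift {Θ : MCtx S μ} {n k : ℕ} {Γ : Ctx S μ n} {Δ : Ctx S μ k}
    {σ : Fin n → Tm S μ k} (h : TypedSubst T Θ Γ Δ σ) (A : Ty S μ n) :
    TypedSubst T Θ (Γ.snoc A) (Δ.snoc (A.subst σ)) (Expr.liftSubst σ) := by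
  intro i
  induction i using Fin.lastCases with
  | last =>
    rw [Ctx.lookup_last, Expr.liftSubst_last, Expr.weaken_subst_liftSubst, ← Ctx.lookup_last Δ]
    exact .var _
  | cast i =>
    rw [Ctx.lookup_castSucc, Expr.liftSubst_castSucc, Expr.weaken_subst_liftSubst]
    exact (h i).weaken_hasTy _

theorem TypedSubst.snoc {Θ : MCtx S μ} {n k : ℕ} {Γ : Ctx S μ n} {Δ : Ctx S μ k}
    {σ : Fin n → Tm S μ k} (h : TypedSubst T Θ Γ Δ σ) {A : Ty S μ n} {t : Tm S μ k}
    (ht : Der T Θ Δ (.jdg (.hasTy t (A.subst σ)))) :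
    TypedSubst T Θ (Γ.snoc A) Δ (Expr.snocSubst σ t) := by
  intro i
  induction i using Fin.lastCases with
  | last => simpa using ht
  | cast i => simpa using h i

theorem actionClass_substitution (Θ : MCtx S μ) :
    ActionClass T Θ Θ (fun Γ Δ I σ => I = (fun _ x => x.genapp) ∧ TypedSubst T Θ Γ Δ σ) where
  lift := by
    rintro n k Γ Δ I σ A ⟨rfl, h⟩
    rw [Expr.act_genapp]
    exact ⟨by simp, h.lift A⟩
  var := by
    rintro n k Γ Δ I σ ⟨rfl, h⟩ i
    rw [Expr.act_genapp]
    exact h i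
  mv := by
    rintro n k Γ Δ I σ ⟨rfl, h⟩ c m x ts
    rw [Bdry.act_genapp, MVar.genapp_inst]
    exact Der.mv_subst _ _
  mvCongr := by
    rintro n k Γ Δ I σ ⟨rfl, h⟩ o m x ss ts
    rw [Bdry.act_genapp, MVar.genapp_inst, MVar.genapp_inst]
    exact Der.mvCongr_subst _ _ _

theorem Der.subst {Θ : MCtx S μ} {n k : ℕ} {Γ : Ctx S μ n} {Δ : Ctx S μ k}
    {σ : Fin n → Tm S μ k} {X : Stmt S μ n} (h : Der T Θ Γ X) (hσ : TypedSubst T Θ Γ Δ σ) :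
    Der T Θ Δ (X.act (fun _ x => x.genapp) σ) :=
  (actionClass_substitution Θ).der h ⟨rfl, hσ⟩

/-! ### Substitution of equal terms -/

/-- The substitutions `σ` and `τ` from `Γ` to `Δ` are well typed and equal. -/
structure EqualSubst (T : RawTheory.{u, v} S) (Θ : MCtx S μ) {n k : ℕ} (Γ : Ctx S μ n)
    (Δ : Ctx S μ k) (σ τ : Fin n → Tm S μ k) : Prop where
  left : TypedSubst T Θ Γ Δ σ
  right : TypedSubst T Θ Γ Δ τ
  eq : ∀ i, Der T Θ Δ (.jdg (.eqTm (σ i) (τ i) ((Γ.lookup i).subst σ)))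

theorem EqualSubst.lift {Θ : MCtx S μ} {n k : ℕ} {Γ : Ctx S μ n} {Δ : Ctx S μ k}
    {σ τ : Fin n → Tm S μ k} (h : EqualSubst T Θ Γ Δ σ τ) {A : Ty S μ n}
    (hA : Der T Θ Δ (.jdg (.eqTy (A.subst σ) (A.subst τ)))) :
    EqualSubst T Θ (Γ.snoc A) (Δ.snoc (A.subst σ)) (Expr.liftSubst σ) (Expr.liftSubst τ) where
  left := h.left.lift A
  right := by
    intro i
    induction i using Fin.lastCases with
    | last =>
      rw [Ctx.lookup_last, Expr.liftSubst_last, Expr.weaken_subst_liftSubst]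
      -- The new variable is declared with type `A.subst σ`, but the right substitution wants it at
      -- `A.subst τ`; hence the hypothesis that these types are equal.
      refine .convTm (.var _) ?_
      rw [Ctx.lookup_last]
      exact hA.weaken_eqTy _
    | cast i =>
      rw [Ctx.lookup_castSucc, Expr.liftSubst_castSucc, Expr.weaken_subst_liftSubst]
      exact (h.right i).weaken_hasTy _
  eq := by
    intro i
    induction i using Fin.lastCases with
    | last =>
      rw [Ctx.lookup_last, Expr.liftSubst_last, Expr.liftSubst_last, Expr.weaken_subst_liftSubst,
        ← Ctx.lookup_last Δ]
      exact .tmRefl (.var _)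
    | cast i =>
      rw [Ctx.lookup_castSucc, Expr.liftSubst_castSucc, Expr.liftSubst_castSucc,
        Expr.weaken_subst_liftSubst]
      exact (h.eq i).weaken_eqTm _

/-- The equation between two object judgements of the same form; nothing for other judgements. -/
def Judg.eqn {n : ℕ} : Judg S μ n → Judg S μ n → Option (Judg S μ n)
  | isTy A, isTy B => some (eqTy A B)
  | hasTy s A, hasTy t _ => some (eqTm s t A)
  | abs A J, abs _ J' => (J.eqn J').map (abs A)
  | _, _ => none

/-- The equation between two object judgements or two term boundaries. -/
def Stmt.eqn {n : ℕ} : Stmt S μ n → Stmt S μ n → Option (Judg S μ n)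
  | jdg J, jdg J' => J.eqn J'
  | bdry (.tm A), bdry (.tm B) => some (.eqTy A B)
  | _, _ => none

theorem Bdry.plug_eqn {n m : ℕ} {o : Obj} (B B' : Bdry S μ n ⟨.obj o, m⟩)
    (e e' : Expr S μ n ⟨.obj o, m⟩) : (B.plug e).eqn (B'.plug e') = some (B.plugEq e e') := by
  induction m generalizing n with
  | zero => cases B <;> cases B' <;> rfl
  | succ m ih =>
    cases B with | abs A B =>
    cases B' with | abs A' B' =>
    cases e with | abs e =>
    cases e' with | abs e' =>
    simp [plug, plugEq, Judg.eqn, ih]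

theorem Bdry.plug_eqn_eq {n : ℕ} {o : Obj} (B B' : Bdry S μ n ⟨.eq o, 0⟩)
    (e e' : Expr S μ n ⟨.eq o, 0⟩) : (B.plug e).eqn (B'.plug e') = none := by
  cases B <;> cases B' <;> rfl

theorem Bdry.plugEq_eqn {n : ℕ} {o : Obj} (B : Bdry S μ n ⟨.obj o, 0⟩)
    (e e' : Expr S μ n ⟨.obj o, 0⟩) (J : Judg S μ n) : (B.plugEq e e').eqn J = none := by
  cases B <;> rfl

theorem Bdry.tyEqn_eq_eqn {n : ℕ} {o : Obj} (B B' : Bdry S μ n ⟨.obj o, 0⟩) :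
    B.tyEqn B' = (Stmt.bdry B).eqn (.bdry B') := by
  cases B <;> cases B' <;> rfl

theorem Der.specific_of_eq {Θ : MCtx S μ} {n : ℕ} {Γ : Ctx S μ n} {i : T.Idx} {R : RawRule S}
    (hR : T.rule i = R) (I : Inst S R.shape μ n)
    (hI : ∀ α (x : MVar R.shape α),
      Der T Θ Γ (.jdg (((R.prems.bdry x).act (I.upto x) Fin.elim0).plug (I α x))))
    (hB : Der T Θ Γ (.bdry (R.bdry.act I Fin.elim0))) :
    Der T Θ Γ (.jdg (R.concl.act I Fin.elim0)) := by
  subst hR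
  exact .specific i I hI hB

/-- The congruence rule, phrased through `eqn` so that it also covers equality rules, whose
conclusions produce no equation. -/
theorem Der.eqn_instances {Θ : MCtx S μ} {n : ℕ} {Γ : Ctx S μ n} {i : T.Idx} {R : RawRule S}
    (hR : T.rule i = R) (I J : Inst S R.shape μ n)
    (hI : ∀ α (x : MVar R.shape α),
      Der T Θ Γ (.jdg (((R.prems.bdry x).act (I.upto x) Fin.elim0).plug (I α x))))
    (hJ : ∀ α (x : MVar R.shape α),
      Der T Θ Γ (.jdg (((R.prems.bdry x).act (J.upto x) Fin.elim0).plug (J α x))))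
    (hIJ : ∀ (o' : Obj) (m : ℕ) (x : MVar R.shape ⟨.obj o', m⟩),
      Der T Θ Γ (.jdg (((R.prems.bdry x).act (I.upto x) Fin.elim0).plugEq (I _ x) (J _ x))))
    (hB : ∀ E ∈ (Stmt.bdry (R.bdry.act I Fin.elim0)).eqn (.bdry (R.bdry.act J Fin.elim0)),
      Der T Θ Γ (.jdg E)) :
    ∀ E ∈ (R.concl.act I Fin.elim0).eqn (R.concl.act J Fin.elim0), Der T Θ Γ (.jdg E) := by
  intro E hE
  obtain ⟨κ, Ξ, c, B, e⟩ := R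
  simp only [RawRule.concl, Bdry.plug_act] at hE
  cases c with
  | eq o => simp [Bdry.plug_eqn_eq] at hE
  | obj o =>
    rw [Bdry.plug_eqn] at hE
    obtain rfl := Option.some.inj hE
    rw [← Bdry.tyEqn_eq_eqn] at hB
    exact .congr i hR I J hI hJ hIJ hB

/-- Each object rule is matched by its congruence rule. Term boundaries take part in the induction
because congruence rules ask for an equation between the two types, which comes from the boundary
premise of the object rule. Typing both substitutions in `EqualSubst` supplies the premises for each
side by ordinary substitution. -/
theorem Der.eqn_subst {Θ : MCtx S μ} {n k : ℕ} {Γ : Ctx S μ n} {Δ : Ctx S μ k}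
    {σ τ : Fin n → Tm S μ k} {X : Stmt S μ n} (hX : Der T Θ Γ X)
    (h : EqualSubst T Θ Γ Δ σ τ) :
    ∀ E ∈ (X.act (fun _ x => x.genapp) σ).eqn (X.act (fun _ x => x.genapp) τ),
      Der T Θ Δ (.jdg E) := by
  induction hX generalizing k with
  | var i =>
    rintro E ⟨⟩
    simpa [Expr.act_genapp, Expr.subst] using h.eq i
  | @mv n Γ c m x ts hts hB ih ihB =>
    intro E hE
    simp only [Stmt.act, Stmt.eqn, Bdry.plug_act, Bdry.act_inst_closed, Bdry.act_genapp,
      MVar.app_act, MVar.genapp_inst, Expr.act_genapp] at hE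
    cases c with
    | eq o => simp [Bdry.plug_eqn_eq] at hE
    | obj o =>
      rw [Bdry.plug_eqn] at hE
      obtain rfl := Option.some.inj hE
      refine .mvCongr_subst x _ _ (fun j => ?_) (fun j => ?_) (fun j => ?_) (fun E hE => ?_)
      · simpa [Stmt.act, Judg.act, Bdry.act_argTy_closed, Bdry.act_genapp, Expr.act_genapp] using
          (hts j).subst h.left
      · simpa [Stmt.act, Judg.act, Bdry.act_argTy_closed, Bdry.act_genapp, Expr.act_genapp] using
          (hts j).subst h.right
      · simpa [Stmt.act, Stmt.eqn, Judg.eqn, Judg.act, Bdry.act_argTy_closed, Bdry.act_genapp,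
          Expr.act_genapp] using ih j h
      · refine ihB h E ?_
        simpa [Stmt.act, ← Bdry.tyEqn_eq_eqn, Bdry.act_inst_closed, Bdry.act_genapp,
          Expr.act_genapp] using hE
  | abstr hA _ ihA ihJ =>
    intro E hE
    simp only [Stmt.act, Stmt.eqn, Judg.act, Judg.eqn, Option.mem_map, MVar.genapp_weaken] at hE
    obtain ⟨E, hE, rfl⟩ := hE
    -- The equation `A.subst σ ≡ A.subst τ` is what allows the pair of substitutions to pass under
    -- the binder.
    have hA' := ihA h _ rfl
    rw [Expr.act_genapp, Expr.act_genapp] at hA'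
    refine .abstr (hA.subst h.left) (ihJ (Δ := Δ.snoc _) ?_ E hE)
    rw [Expr.act_genapp]
    exact h.lift hA'
  | convTm _ hAB ih _ =>
    rintro E ⟨⟩
    exact .convEq (ih h _ rfl) (hAB.subst h.left)
  | bdryTm _ ih =>
    rintro E ⟨⟩
    exact ih h _ rfl
  | specific i J hJ _ ih ihB =>
    intro E hE
    simp only [Stmt.act, Stmt.eqn, Judg.act_act_closed] at hE
    refine Der.eqn_instances rfl _ _ (fun α x => ?_) (fun α x => ?_) (fun o m x => ?_) ?_ E hE
    · simpa [Stmt.act, Bdry.plug_act, Bdry.act_act_closed, Inst.upto_act]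
        using (hJ α x).subst h.left
    · simpa [Stmt.act, Bdry.plug_act, Bdry.act_act_closed, Inst.upto_act]
        using (hJ α x).subst h.right
    · refine ih _ x h _ ?_
      simp [Stmt.act, Stmt.eqn, Bdry.plug_act, Bdry.plug_eqn, Bdry.act_act_closed, Inst.upto_act]
    · simpa [Stmt.act, Bdry.act_act_closed] using ihB h
  | mvCongr | congr =>
    intro E hE
    simp [Stmt.act, Stmt.eqn, Bdry.plugEq_act, Bdry.plugEq_eqn] at hE
  | _ => rintro E ⟨⟩

/-! ### Inversion of abstractions and instances of abstracted judgements -/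

theorem Bdry.plug_ne_abs {n : ℕ} {c : Cls} (B : Bdry S μ n ⟨c, 0⟩) (e : Expr S μ n ⟨c, 0⟩)
    (A : Ty S μ n) (J : Judg S μ (n + 1)) : B.plug e ≠ .abs A J := by
  cases B <;> simp [plug]

theorem Bdry.plugEq_ne_abs {n : ℕ} {o : Obj} (B : Bdry S μ n ⟨.obj o, 0⟩)
    (e e' : Expr S μ n ⟨.obj o, 0⟩) (A : Ty S μ n) (J : Judg S μ (n + 1)) :
    B.plugEq e e' ≠ .abs A J := by
  cases B <;> simp [plugEq]

/-- Every rule other than abstraction concludes a thesis without binders. -/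
theorem Der.abs_inv {Θ : MCtx S μ} {n : ℕ} {Γ : Ctx S μ n} {A : Ty S μ n} {J : Judg S μ (n + 1)}
    (h : Der T Θ Γ (.jdg (.abs A J))) :
    Der T Θ Γ (.jdg (.isTy A)) ∧ Der T Θ (Γ.snoc A) (.jdg J) := by
  generalize hX : Stmt.jdg (.abs A J) = X at h
  cases h with
  | abstr hA hJ =>
    simp only [Stmt.jdg.injEq, Judg.abs.injEq] at hX
    obtain ⟨rfl, rfl⟩ := hX
    exact ⟨hA, hJ⟩
  | mv | specific =>
    simp only [Stmt.jdg.injEq, RawRule.concl, Bdry.plug_act] at hX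
    exact absurd hX.symm (Bdry.plug_ne_abs _ _ _ _)
  | mvCongr | congr =>
    simp only [Stmt.jdg.injEq] at hX
    exact absurd hX.symm (Bdry.plugEq_ne_abs _ _ _ _ _)
  | _ => simp at hX

theorem Der.plug_inst {Θ : MCtx S μ} {n k m : ℕ} {c : Cls} {Γ : Ctx S μ n} {Δ : Ctx S μ k}
    {B : Bdry S μ n ⟨c, m⟩} {e : Expr S μ n ⟨c, m⟩} (h : Der T Θ Γ (.jdg (B.plug e)))
    {σ : Fin n → Tm S μ k} {ts : Fin m → Tm S μ k} (hσ : TypedSubst T Θ Γ Δ σ)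
    (hts : ∀ j, Der T Θ Δ (.jdg (.hasTy (ts j) (B.argTy σ ts j)))) :
    Der T Θ Δ (.jdg ((B.inst σ ts).plug (e.inst σ ts))) := by
  induction m generalizing n with
  | zero =>
    simpa [Stmt.act, Bdry.plug_act, Bdry.act_genapp, Expr.act_genapp, Bdry.inst, Expr.inst]
      using h.subst hσ
  | succ m ih =>
    cases B with | abs A B =>
    cases e with | abs e =>
    exact ih h.abs_inv.2 (hσ.snoc (hts 0)) (fun j => hts j.succ)

theorem EqualSubst.snoc {Θ : MCtx S μ} {n k : ℕ} {Γ : Ctx S μ n} {Δ : Ctx S μ k}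
    {σ τ : Fin n → Tm S μ k} (h : EqualSubst T Θ Γ Δ σ τ) {A : Ty S μ n} {s t : Tm S μ k}
    (hs : Der T Θ Δ (.jdg (.hasTy s (A.subst σ))))
    (ht : Der T Θ Δ (.jdg (.hasTy t (A.subst τ))))
    (he : Der T Θ Δ (.jdg (.eqTm s t (A.subst σ)))) :
    EqualSubst T Θ (Γ.snoc A) Δ (Expr.snocSubst σ s) (Expr.snocSubst τ t) where
  left := h.left.snoc hs
  right := h.right.snoc ht
  eq := by
    intro i
    induction i using Fin.lastCases with
    | last => simpa using he
    | cast i => simpa using h.eq i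

theorem Der.plugEq_inst {Θ : MCtx S μ} {n k m : ℕ} {o : Obj} {Γ : Ctx S μ n} {Δ : Ctx S μ k}
    {B : Bdry S μ n ⟨.obj o, m⟩} {e : Expr S μ n ⟨.obj o, m⟩} (h : Der T Θ Γ (.jdg (B.plug e)))
    {σ τ : Fin n → Tm S μ k} {ss ts : Fin m → Tm S μ k} (hστ : EqualSubst T Θ Γ Δ σ τ)
    (hss : ∀ j, Der T Θ Δ (.jdg (.hasTy (ss j) (B.argTy σ ss j))))
    (hts : ∀ j, Der T Θ Δ (.jdg (.hasTy (ts j) (B.argTy τ ts j))))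
    (he : ∀ j, Der T Θ Δ (.jdg (.eqTm (ss j) (ts j) (B.argTy σ ss j)))) :
    Der T Θ Δ (.jdg ((B.inst σ ss).plugEq (e.inst σ ss) (e.inst τ ts))) := by
  induction m generalizing n with
  | zero =>
    have := h.eqn_subst hστ
    simp only [Stmt.act, Stmt.eqn, Bdry.plug_act, Bdry.plug_eqn, Bdry.act_genapp,
      Expr.act_genapp] at this
    exact this _ rfl
  | succ m ih =>
    cases B with | abs A B =>
    cases e with | abs e =>
    exact ih h.abs_inv.2 (hστ.snoc (hss 0) (hts 0) (he 0)) (fun j => hss j.succ)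
      (fun j => hts j.succ) (fun j => he j.succ)

/-! ### Derivable instantiations -/

theorem EqualSubst.refl_var {Θ : MCtx S μ} {n : ℕ} (Γ : Ctx S μ n) :
    EqualSubst T Θ Γ Γ .var .var :=
  ⟨.var Γ, .var Γ, fun i => .tmRefl (TypedSubst.var Γ i)⟩

theorem Inst.Derivable.weaken {Ξ : MCtx S μ} {Θ : MCtx S ν} {n : ℕ} {Γ : Ctx S ν n}
    {I : Inst S μ ν n} (h : I.Derivable T Ξ Θ Γ) (A : Ty S ν n) :
    Inst.Derivable T Ξ Θ (Γ.snoc A) (fun β x => (I β x).weaken) := by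
  intro α x
  have := (h α x).weaken A
  simp only [Stmt.act, Bdry.plug_act, Bdry.act_act_closed, Expr.act_genapp_castSucc] at this
  exact this

/-- An application `M(t⃗)` becomes the argument `I(M)` with `t⃗` substituted, so the metavariable
rule turns into substitution in a derivable abstraction, and its congruence rule into substitution
of equal terms. -/
theorem actionClass_instantiation (Ξ : MCtx S μ) (Θ : MCtx S ν) :
    ActionClass T Ξ Θ (fun Γ Δ I σ => I.Derivable T Ξ Θ Δ ∧
      ∀ i, Der T Θ Δ (.jdg (.hasTy (σ i) ((Γ.lookup i).act I σ)))) where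
  lift := by
    rintro n k Γ Δ I σ A ⟨hI, h⟩
    refine ⟨hI.weaken _, fun i => ?_⟩
    induction i using Fin.lastCases with
    | last =>
      rw [Ctx.lookup_last, Expr.liftSubst_last, Expr.weaken_act_liftSubst, ← Ctx.lookup_last Δ]
      exact .var _
    | cast i =>
      rw [Ctx.lookup_castSucc, Expr.liftSubst_castSucc, Expr.weaken_act_liftSubst]
      exact (h i).weaken_hasTy _
  var := fun h => h.2
  mv := by
    rintro n k Γ Δ I σ ⟨hI, -⟩ c m x ts hts -
    rw [MCtx.lookup_act] at *
    exact (hI _ x).plug_inst (.var Δ) hts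
  mvCongr := by
    rintro n k Γ Δ I σ ⟨hI, -⟩ o m x ss ts hss hts he -
    rw [MCtx.lookup_act] at *
    exact (hI _ x).plugEq_inst (.refl_var Δ) hss hts he

theorem Inst.Derivable.der {Ξ : MCtx S μ} {Θ : MCtx S ν} {n : ℕ} {Γ : Ctx S ν n}
    {I : Inst S μ ν n} (hI : I.Derivable T Ξ Θ Γ) {X : Stmt S μ 0} (h : Der T Ξ .nil X) :
    Der T Θ Γ (X.act I Fin.elim0) :=
  (actionClass_instantiation Ξ Θ).der h ⟨hI, fun i => i.elim0⟩

/-- Renaming of metavariables preserves derivability. -/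
theorem Der.renameMv {Ξ : MCtx S μ} {Θ : MCtx S ν} {f : ∀ α, MVar μ α → MVar ν α}
    (hf : ∀ α (x : MVar μ α), Θ.lookup (f α x) = (Ξ.lookup x).renameMv f) {X : Stmt S μ 0}
    (h : Der T Ξ .nil X) :
    Der T Θ .nil (X.act (fun β x => (f β x).genapp) Fin.elim0) :=
  (actionClass_renaming f hf).der h ⟨Fin.elim0, rfl, Subsingleton.elim _ _, fun i => i.elim0⟩

/-- The generic application of an equality metavariable with a derivable boundary is derivable. -/
theorem Der.dummy_of_inst {Θ : MCtx S μ} {n m : ℕ} {o : Obj} {Γ : Ctx S μ n}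
    {B : Bdry S μ n ⟨.eq o, m⟩} (hB : Der T Θ Γ (.bdry B))
    (h : ∀ {k : ℕ} (Δ : Ctx S μ k) (σ : Fin n → Tm S μ k) (ts : Fin m → Tm S μ k),
      TypedSubst T Θ Γ Δ σ → (∀ j, Der T Θ Δ (.jdg (.hasTy (ts j) (B.argTy σ ts j)))) →
      Der T Θ Δ (.bdry (B.inst σ ts)) → Der T Θ Δ (.jdg ((B.inst σ ts).plug .dummy)))
    (e : Expr S μ n ⟨.eq o, m⟩) : Der T Θ Γ (.jdg (B.plug e)) := by
  induction m generalizing n with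
  | zero =>
    rw [Subsingleton.elim e .dummy]
    simpa [Bdry.inst, Bdry.subst_var] using
      h Γ .var Fin.elim0 (.var Γ) (fun j => j.elim0) (by simpa [Bdry.inst, Bdry.subst_var] using hB)
  | succ m ih =>
    cases B with | abs A B =>
    cases e with | abs e =>
    cases hB with | bdryAbstr hA hB =>
    refine .abstr hA (ih hB (fun {k} Δ σ ts hσ hts hI => ?_) e)
    -- Quantifying over all typed instances makes the induction work: the last component of `σ` is
    -- handed back as the first argument of the metavariable.
    rw [Expr.eq_snocSubst σ] at hI hts ⊢
    refine h Δ (fun i => σ i.castSucc) (Fin.cons (σ (Fin.last n)) ts) (fun i => ?_) (fun j => ?_) hI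
    · have := hσ i.castSucc
      rw [Ctx.lookup_castSucc, Expr.eq_snocSubst σ] at this
      simpa using this
    · induction j using Fin.cases with
      | zero =>
        have := hσ (Fin.last n)
        rw [Ctx.lookup_last, Expr.eq_snocSubst σ] at this
        simpa [Bdry.argTy] using this
      | succ j => exact hts j

theorem Der.eqMv {Θ : MCtx S μ} {m : ℕ} {o : Obj} (x : MVar μ ⟨.eq o, m⟩)
    (h : Der T Θ .nil (.bdry (Θ.lookup x))) (e : Expr S μ 0 ⟨.eq o, m⟩) :
    Der T Θ .nil (.jdg ((Θ.lookup x).plug e)) := by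
  refine h.dummy_of_inst (fun {k} Δ σ ts _ hts hB => ?_) e
  obtain rfl := Subsingleton.elim σ Fin.elim0
  exact .mv x ts hts hB

end Metatheory

/-! ### Inversion, naturality, patterns and the equational residue. -/

section Patterns

variable {S : Signature.{u}} {T : RawTheory.{u, v} S} {μ ν : Shape}

/-! ### Inversion of symbols -/

theorem RawRule.symbol_concl_act {n : ℕ} {o : Obj} (s : S.Sym o) (Ξ : MCtx S (S.args s))
    (B : Bdry S (S.args s) 0 ⟨.obj o, 0⟩) (I : Inst S (symbol s Ξ B).shape μ n) :
    (symbol s Ξ B).concl.act I Fin.elim0 = (B.act I Fin.elim0).plug (.sym s I) := by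
  have h : ∀ I : Inst S (S.args s) μ n, (B.plug (.sym s (fun _ x => x.genapp))).act I Fin.elim0 =
      (B.act I Fin.elim0).plug (.sym s I) := by simp [Bdry.plug_act, Expr.act]
  exact h I

theorem Bdry.plug_eq_sym {n : ℕ} {o o' : Obj} {s : S.Sym o} {s' : S.Sym o'}
    {es : Inst S (S.args s) μ n} {es' : Inst S (S.args s') μ n} {B : Bdry S μ n ⟨.obj o, 0⟩}
    {B' : Bdry S μ n ⟨.obj o', 0⟩} (h : B.plug (.sym s es) = B'.plug (.sym s' es')) :
    ∃ ho : o = o', ho ▸ s = s' ∧ HEq es es' := by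
  cases B <;> cases B' <;> simp_all [plug]

theorem RawTheory.IsStandard.rule_unique (hT : T.IsStandard) {o : Obj} {s : S.Sym o}
    {i i' : T.Idx} {Ξ Ξ' : MCtx S (S.args s)} {B B' : Bdry S (S.args s) 0 ⟨.obj o, 0⟩}
    (h : T.rule i = .symbol s Ξ B) (h' : T.rule i' = .symbol s Ξ' B') : Ξ = Ξ' ∧ B = B' := by
  obtain rfl := (hT.unique o s).unique ⟨Ξ, B, h⟩ ⟨Ξ', B', h'⟩
  simpa [RawRule.symbol] using h.symm.trans h'

/-- Only conversion and instances of the symbol rule of `s` can conclude such a judgement.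
Conversion changes the type alone, and the type does not occur in the conclusion of the lemma;
uniqueness of the symbol rule identifies the premises. -/
theorem Der.sym_inv (hT : T.IsStandard) {Θ : MCtx S μ} {n : ℕ} {Γ : Ctx S μ n} {o : Obj}
    {s : S.Sym o} {es : Inst S (S.args s) μ n} {C : Bdry S μ n ⟨.obj o, 0⟩}
    (h : Der T Θ Γ (.jdg (C.plug (.sym s es)))) {i : T.Idx} {Ξ : MCtx S (S.args s)}
    {B : Bdry S (S.args s) 0 ⟨.obj o, 0⟩} (hi : T.rule i = .symbol s Ξ B) :
    es.Derivable T Ξ Θ Γ ∧ Der T Θ Γ (.bdry (B.act es Fin.elim0)) := by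
  generalize hX : Stmt.jdg (C.plug (.sym s es)) = X at h
  induction h with
  | @mv n Γ c m x ts =>
    simp only [Stmt.jdg.injEq] at hX
    generalize (Θ.lookup x).inst Fin.elim0 ts = D at hX
    cases D <;> cases C <;> simp [Bdry.plug, MVar.app] at hX
  | @convTm n Γ t A A' _ _ ih =>
    cases C with
    | ty => simp [Bdry.plug] at hX
    | tm C =>
      simp only [Bdry.plug, Stmt.jdg.injEq, Judg.hasTy.injEq] at hX
      obtain ⟨rfl, rfl⟩ := hX
      exact ih (C := .tm A) rfl
  | specific j I hI hB =>
    simp only [Stmt.jdg.injEq] at hX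
    -- The shape of the rule occurs in the type of `I`, so the rule is made a variable before it is
    -- replaced by its symbol form.
    generalize hR : T.rule j = R at *
    rcases hc : R.cls with o' | o'
    · obtain ⟨o'', s', Ξ', B', h⟩ := hT.objRule j o' (by rw [hR, hc])
      obtain rfl := hR.symm.trans h
      rw [RawRule.symbol_concl_act] at hX
      obtain ⟨rfl, rfl, hes⟩ := Bdry.plug_eq_sym hX
      obtain rfl := eq_of_heq hes
      obtain ⟨rfl, rfl⟩ := hT.rule_unique hi hR
      exact ⟨hI, hB⟩
    · obtain ⟨κ, Ξ', c, B', e⟩ := R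
      obtain rfl : c = .eq o' := hc
      simp only [RawRule.concl, Bdry.plug_act] at hX
      generalize B'.act I Fin.elim0 = D at hX
      cases D <;> cases C <;> simp [Bdry.plug] at hX
  | @mvCongr n Γ o m x ss =>
    simp only [Stmt.jdg.injEq] at hX
    generalize (Θ.lookup x).inst Fin.elim0 ss = D at hX
    cases D <;> cases C <;> simp [Bdry.plug, Bdry.plugEq] at hX
  | @congr n Γ i κ Ξ o B e _ I =>
    simp only [Stmt.jdg.injEq] at hX
    generalize B.act I Fin.elim0 = D at hX
    cases D <;> cases C <;> simp [Bdry.plug, Bdry.plugEq] at hX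
  | _ => cases C <;> simp [Bdry.plug] at hX

theorem Bdry.plug_eq_hasTy {n : ℕ} (B : Bdry S μ n ⟨.obj .tm, 0⟩) (t : Tm S μ n) :
    B.plug t = .hasTy t B.type := by
  cases B
  rfl

/-- A term symbol application that has some type has its natural type. -/
theorem Der.natTy (hT : T.IsStandard) {Θ : MCtx S μ} {n : ℕ} {Γ : Ctx S μ n} {s : S.Sym .tm}
    {es : Inst S (S.args s) μ n} {A : Ty S μ n} (h : Der T Θ Γ (.jdg (.hasTy (.sym s es) A))) :
    Der T Θ Γ (.jdg (.hasTy (.sym s es) (hT.natTy Θ Γ (.sym s es)))) := by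
  -- `natTy` is computed from the chosen boundary `symBdry`, so the inversion is made for exactly
  -- this choice.
  obtain ⟨i, hi⟩ := (hT.exists_rule s).choose_spec
  obtain ⟨hes, hB⟩ := Der.sym_inv hT (C := .tm A) h hi
  have := congrArg (fun J => Der T Θ Γ (.jdg J)) (RawRule.symbol_concl_act s _ _ es) |>.mp
    (Der.specific_of_eq hi es hes hB)
  rw [Bdry.plug_eq_hasTy] at this
  exact this

/-! ### Inversion of naturality for variables -/

theorem Natural.abs_inv {Θ : MCtx S μ} {n : ℕ} {Γ : Ctx S μ n} {A : Ty S μ n}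
    {J : Judg S μ (n + 1)} (h : Natural T Θ Γ (.abs A J)) : Natural T Θ (Γ.snoc A) J := by
  generalize hX : Judg.abs A J = X at h
  cases h with
  | abs h =>
    simp only [Judg.abs.injEq] at hX
    obtain ⟨rfl, rfl⟩ := hX
    exact h
  | var => simp at hX
  | mv | sym => exact absurd hX.symm (Bdry.plug_ne_abs _ _ _ _)

theorem Natural.var_inv {Θ : MCtx S μ} {n : ℕ} {Γ : Ctx S μ n} {i : Fin n} {A : Ty S μ n}
    (h : Natural T Θ Γ (.hasTy (.var i) A)) : Γ.lookup i = A := by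
  generalize hX : Judg.hasTy (.var i) A = X at h
  cases h with
  | var => simp_all
  | abs => simp at hX
  | mv x ts =>
    generalize (Θ.lookup x).inst Fin.elim0 ts = D at hX
    cases D <;> simp [Bdry.plug] at hX
  | sym s j h es B' => cases B' <;> simp [Bdry.plug] at hX

/-- Without conversion a metavariable application has just one possible boundary. For symbols, by
contrast, the boundary is left free. -/
theorem Natural.mv_inv {Θ : MCtx S μ} {n m : ℕ} {o : Obj} {Γ : Ctx S μ n}
    {x : MVar μ ⟨.obj o, m⟩} {ts : Fin m → Tm S μ n} {C : Bdry S μ n ⟨.obj o, 0⟩}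
    (h : Natural T Θ Γ (C.plug (.mv x ts))) :
    C = (Θ.lookup x).inst Fin.elim0 ts ∧
      ∀ j, Natural T Θ Γ (.hasTy (ts j) ((Θ.lookup x).argTy Fin.elim0 ts j)) := by
  generalize hX : C.plug (.mv x ts) = X at h
  cases h with
  | var | abs => cases C <;> simp [Bdry.plug] at hX
  | @mv _ _ o' m' x' ts' h =>
    generalize hD : (Θ.lookup x').inst Fin.elim0 ts' = D at hX
    cases D <;> cases C <;> simp only [Bdry.plug, Judg.isTy.injEq, Judg.hasTy.injEq,
      Expr.mv.injEq, reduceCtorEq] at hX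
    · obtain ⟨rfl, h1, h2⟩ := hX
      obtain rfl := eq_of_heq h1
      obtain rfl := eq_of_heq h2
      exact ⟨hD.symm, h⟩
    · obtain ⟨⟨rfl, h1, h2⟩, rfl⟩ := hX
      obtain rfl := eq_of_heq h1
      obtain rfl := eq_of_heq h2
      exact ⟨hD.symm, h⟩
  | sym s j h es B' => cases B' <;> cases C <;> simp [Bdry.plug] at hX

theorem Natural.sym_inv {Θ : MCtx S μ} {n : ℕ} {Γ : Ctx S μ n} {o : Obj}
    {s : S.Sym o} {es : Inst S (S.args s) μ n} {C : Bdry S μ n ⟨.obj o, 0⟩}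
    (h : Natural T Θ Γ (C.plug (.sym s es))) :
    ∃ (i : T.Idx) (Ξ : MCtx S (S.args s)) (B : Bdry S (S.args s) 0 ⟨.obj o, 0⟩),
      T.rule i = .symbol s Ξ B ∧ ∀ (o' : Obj) (m : ℕ) (x : MVar (S.args s) ⟨.obj o', m⟩),
        Natural T Θ Γ (((Ξ.bdry x).act (es.upto x) Fin.elim0).plug (es _ x)) := by
  generalize hX : C.plug (.sym s es) = X at h
  cases h with
  | var | abs => cases C <;> simp [Bdry.plug] at hX
  | @mv _ _ o' m' x' ts' h =>
    generalize hD : (Θ.lookup x').inst Fin.elim0 ts' = D at hX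
    cases D <;> cases C <;> simp [Bdry.plug] at hX
  | sym s' j hj es' B' h =>
    obtain ⟨rfl, rfl, hes⟩ := Bdry.plug_eq_sym hX
    obtain rfl := eq_of_heq hes
    exact ⟨j, _, _, hj, h⟩

/-- Opening all the binders of a natural judgement. -/
theorem Natural.exists_inst {Θ : MCtx S μ} {n m : ℕ} {c : Cls} {Γ : Ctx S μ n}
    {B : Bdry S μ n ⟨c, m⟩} {e : Expr S μ n ⟨c, m⟩} (h : Natural T Θ Γ (B.plug e)) :
    ∃ (k : ℕ) (Δ : Ctx S μ k) (ρ : Fin n → Fin k) (θ : Fin m → Fin k) (C : Bdry S μ k ⟨c, 0⟩),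
      Function.Injective ρ ∧ (∀ i, Δ.lookup (ρ i) = (Γ.lookup i).rename ρ) ∧
      Natural T Θ Δ (C.plug (e.inst (fun i => .var (ρ i)) (fun j => .var (θ j)))) := by
  induction m generalizing n with
  | zero =>
    refine ⟨n, Γ, id, Fin.elim0, B, Function.injective_id, fun i => by simp [Expr.rename_id], ?_⟩
    simpa [Expr.inst, Expr.subst_var] using h
  | succ m ih =>
    cases B with | abs A B =>
    cases e with | abs e =>
    obtain ⟨k, Δ, ρ, θ, C, hρ, hΔ, hC⟩ := ih h.abs_inv
    refine ⟨k, Δ, ρ ∘ Fin.castSucc, Fin.cons (ρ (Fin.last n)) θ, C,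
      hρ.comp (Fin.castSucc_injective n), fun i => ?_, ?_⟩
    · rw [Function.comp_apply, hΔ, Ctx.lookup_castSucc, Expr.weaken, Expr.rename_rename]
    · rw [Expr.eq_snocSubst (fun i => Expr.var (ρ i))] at hC
      exact hC

/-- With all binders opened to variables, `hL` says that the thesis and the types of the opened
variables are those prescribed by `L`. Since the opening is an injective renaming, these equalities
descend to the abstracted boundaries, one binder at a time. -/
theorem Natural.bdry_unique {Θ : MCtx S μ} {n m : ℕ} {c : Cls} {Γ : Ctx S μ n}
    {B L : Bdry S μ n ⟨c, m⟩} {e : Expr S μ n ⟨c, m⟩} (h : Natural T Θ Γ (B.plug e))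
    (hL : ∀ {k : ℕ} (Δ : Ctx S μ k) (ρ : Fin n → Fin k) (θ : Fin m → Fin k)
      (C : Bdry S μ k ⟨c, 0⟩),
      Natural T Θ Δ (C.plug (e.inst (fun i => .var (ρ i)) (fun j => .var (θ j)))) →
      C = L.inst (fun i => .var (ρ i)) (fun j => .var (θ j)) ∧
      ∀ j, Δ.lookup (θ j) = L.argTy (fun i => .var (ρ i)) (fun j => .var (θ j)) j) : B = L := by
  induction m generalizing n with
  | zero =>
    have := (hL Γ id Fin.elim0 B (by simpa [Expr.inst, Expr.subst_var] using h)).1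
    simpa [Bdry.inst, Bdry.subst_var] using this
  | succ m ih =>
    cases B with | abs A B =>
    cases L with | abs A' L =>
    cases e with | abs e =>
    have key : ∀ {k : ℕ} (Δ : Ctx S μ k) (ρ : Fin (n + 1) → Fin k) (θ : Fin m → Fin k)
      (C : Bdry S μ k ⟨c, 0⟩),
      Natural T Θ Δ (C.plug (e.inst (fun i => .var (ρ i)) (fun j => .var (θ j)))) →
      (C = L.inst (fun i => .var (ρ i)) (fun j => .var (θ j)) ∧
      ∀ j, Δ.lookup (θ j) = L.argTy (fun i => .var (ρ i)) (fun j => .var (θ j)) j) ∧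
      Δ.lookup (ρ (Fin.last n)) = A'.rename (ρ ∘ Fin.castSucc) := by
      intro k Δ ρ θ C hC
      rw [Expr.eq_snocSubst (fun i => Expr.var (ρ i))] at hC ⊢
      obtain ⟨h1, h2⟩ := hL Δ (ρ ∘ Fin.castSucc) (Fin.cons (ρ (Fin.last n)) θ) C hC
      refine ⟨⟨h1, fun j => h2 j.succ⟩, ?_⟩
      rw [Expr.rename_eq_subst]
      exact h2 0
    -- The type of the outermost variable becomes comparable only after all inner binders are
    -- opened, because naturality constrains it through the application in the body.
    obtain ⟨k, Δ, ρ, θ, C, hρ, hΔ, hC⟩ := h.abs_inv.exists_inst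
    have hA := (key Δ ρ θ C hC).2
    rw [hΔ, Ctx.lookup_last, Expr.weaken, Expr.rename_rename] at hA
    rw [Expr.rename_injective (hρ.comp (Fin.castSucc_injective n)) hA,
      ih h.abs_inv (fun Δ ρ θ C hC => (key Δ ρ θ C hC).1)]

/-- The boundary of a natural generic application is that of the metavariable. -/
theorem Natural.genapp_inv {Θ : MCtx S μ} {m : ℕ} {o : Obj} {x : MVar μ ⟨.obj o, m⟩}
    {B : Bdry S μ 0 ⟨.obj o, m⟩} (h : Natural T Θ .nil (B.plug x.genapp)) : B = Θ.lookup x := by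
  refine h.bdry_unique fun {k} Δ ρ θ C hC => ?_
  rw [MVar.genapp_inst] at hC
  obtain ⟨hC, hx⟩ := hC.mv_inv
  rw [Subsingleton.elim (fun i => Expr.var (ρ i)) Fin.elim0]
  exact ⟨hC, fun j => (hx j).var_inv⟩

/-! ### Patterns -/

/-- Instantiations that agree on a pattern agree on its metavariables. -/
theorem IsPattern.act_inj {k : PatKind} {n : ℕ} {α : Arity} {q : Expr S μ 0 α}
    (hq : IsPattern k q) {I I' : Inst S μ ν n} (h : q.act I Fin.elim0 = q.act I' Fin.elim0) :
    ∀ y ∈ q.mvs, I _ y.2 = I' _ y.2 := by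
  induction hq with
  | typeMv x =>
    simp only [Expr.act, Expr.inst, Expr.subst_var] at h
    rintro y hy
    obtain rfl : y = ⟨_, x⟩ := by simpa [Expr.mvs] using hy
    exact h
  | typeSym s qs _ _ ih | termSym s qs _ _ ih =>
    intro y hy
    simp only [Expr.mvs, Set.mem_iUnion] at hy
    obtain ⟨β, x, hy⟩ := hy
    simp only [Expr.act, Expr.sym.injEq, heq_eq_eq, true_and] at h
    exact ih β x (congrFun (congrFun h β) x) y hy
  | argMv x =>
    rintro y hy
    obtain rfl : y = ⟨_, x⟩ := by simpa [MVar.mvs_genapp] using hy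
    simpa using h
  | argDummy e => simp [Expr.mvs_eq_empty]
  | argType _ ih | argTerm _ ih => exact ih h

/-- If an instance of a natural pattern is derivable, then so are the premises for the object
metavariables that occur in the pattern. -/
theorem IsPattern.der_premise (hT : T.IsStandard) {Ξ : MCtx S μ} {Θ : MCtx S ν} {n : ℕ}
    {Γ : Ctx S ν n} {I : Inst S μ ν n} {k : PatKind} {α : Arity} {q : Expr S μ 0 α}
    (hq : IsPattern k q) {B : Bdry S μ 0 α} (hn : Natural T Ξ .nil (B.plug q))
    (h : Der T Θ Γ (.jdg ((B.act I Fin.elim0).plug (q.act I Fin.elim0)))) :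
    ∀ y ∈ q.mvs,
      Der T Θ Γ (.jdg (((Ξ.bdry y.2).act (I.upto y.2) Fin.elim0).plug (I _ y.2))) := by
  induction hq with
  | typeMv x =>
    rintro y hy
    obtain rfl : y = ⟨_, x⟩ := by simpa [Expr.mvs] using hy
    rw [← MCtx.lookup_act]
    obtain ⟨rfl, -⟩ := hn.mv_inv
    simpa [Expr.act, Expr.inst, Expr.subst_var, Bdry.inst, Bdry.act_subst,
      Subsingleton.elim (fun i : Fin 0 => _) Fin.elim0] using h
  | typeSym s qs _ _ ih | termSym s qs _ _ ih =>
    intro y hy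
    simp only [Expr.mvs, Set.mem_iUnion] at hy
    obtain ⟨⟨o | o, m⟩, x, hy⟩ := hy
    -- The same rule inverts both naturality of the pattern and derivability of its instance, so
    -- both descend to the argument with the same boundary.
    · obtain ⟨i, Ξ', B', hi, hx⟩ := hn.sym_inv
      refine ih _ x (hx o m x) ?_ y hy
      rw [Bdry.act_act_closed]
      exact (Der.sym_inv hT h hi).1 _ x
    · simp [Expr.mvs_eq_empty] at hy
  | argMv x =>
    rintro y hy
    obtain rfl : y = ⟨_, x⟩ := by simpa [MVar.mvs_genapp] using hy
    -- At a leaf, naturality identifies the boundary inherited from the enclosing symbol with that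
    -- of the metavariable in `Ξ`.
    rw [← MCtx.lookup_act, ← hn.genapp_inv]
    simpa using h
  | argDummy e => simp [Expr.mvs_eq_empty]
  | argType _ ih | argTerm _ ih => exact ih hn h

/-! ### The equational residue -/

@[simp] theorem MCtx.lookup_prev {α β : Arity} (Ξ : MCtx S μ) (B : Bdry S μ 0 β) (x : MVar μ α) :
    (Ξ.snoc B).lookup x.prev = (Ξ.lookup x).renameMv (fun _ => .prev) := by
  rw [lookup, lookup, Bdry.renameMv_renameMv]
  rfl

theorem MCtx.lookup_toResidue (Θ : MCtx S ν) (Ξ : MCtx S μ) (I : Inst S μ ν 0) {α : Arity}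
    (x : MVar ν α) :
    (Θ.residue Ξ I).lookup (MVar.toResidue μ α x) =
      (Θ.lookup x).renameMv (MVar.toResidue μ) := by
  induction Ξ with
  | nil => exact (Bdry.renameMv_id _).symm
  | @snoc μ β Ξ B ih =>
    obtain ⟨o | o, m⟩ := β
    · exact ih _
    · exact (lookup_prev _ _ _).trans (by rw [ih, Bdry.renameMv_renameMv]; rfl)

theorem MCtx.exists_lookup_residue (Θ : MCtx S ν) (Ξ : MCtx S μ) (I : Inst S μ ν 0) {o : Obj}
    {m : ℕ} (x : MVar μ ⟨.eq o, m⟩) :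
    ∃ y : MVar (ν.residue μ) ⟨.eq o, m⟩, (Θ.residue Ξ I).lookup y =
      ((Ξ.bdry x).act (I.upto x) Fin.elim0).renameMv (MVar.toResidue μ) := by
  induction Ξ with
  | nil => cases x
  | @snoc μ β Ξ B ih =>
    cases x with
    | last =>
      refine ⟨.last, ?_⟩
      exact Bdry.renameMv_renameMv _ _ _
    | prev x =>
      obtain ⟨y, hy⟩ := ih (fun β z => I β z.prev) x
      obtain ⟨o' | o', m'⟩ := β
      · exact ⟨y, hy⟩
      · exact ⟨y.prev, (lookup_prev _ _ _).trans (by rw [hy, Bdry.renameMv_renameMv]; rfl)⟩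

/-- The residual instantiation is just `I` moved to the larger metavariable context: on equality
metavariables both sides are the unique argument of that arity. Hence instances of boundaries under
`I` and under its residual agree up to renaming. -/
theorem Inst.residual_eq_act (I : Inst S μ ν 0) :
    I.residual = fun β x => (I β x).act (fun γ y => (MVar.toResidue μ γ y).genapp) Fin.elim0 := by
  funext β x
  obtain ⟨o | o, m⟩ := β
  · rw [Subsingleton.elim (Fin.elim0 : Fin 0 → Tm S (ν.residue μ) 0) Expr.var,
      ← Expr.renameMv_eq_act]
    rfl
  · exact Subsingleton.elim _ _

/-- An equality premise may be proved assuming that its boundary is derivable: the preceding part of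
`I` is derivable by induction, and it carries the derivation of the boundary supplied by `Ξ.WF T` to
`Θ; Γ`. -/
theorem Inst.derivable_of_wf {Ξ : MCtx S μ} (hΞ : Ξ.WF T) {Θ : MCtx S ν} {n : ℕ}
    {Γ : Ctx S ν n} {I : Inst S μ ν n}
    (hobj : ∀ (o : Obj) (m : ℕ) (x : MVar μ ⟨.obj o, m⟩),
      Der T Θ Γ (.jdg (((Ξ.bdry x).act (I.upto x) Fin.elim0).plug (I _ x))))
    (heq : ∀ (o : Obj) (m : ℕ) (x : MVar μ ⟨.eq o, m⟩),
      Der T Θ Γ (.bdry ((Ξ.bdry x).act (I.upto x) Fin.elim0)) →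
      Der T Θ Γ (.jdg (((Ξ.bdry x).act (I.upto x) Fin.elim0).plug (I _ x)))) :
    I.Derivable T Ξ Θ Γ := by
  induction hΞ with
  | nil => intro α x; cases x
  | @snoc μ α Ξ B _ hB ih =>
    have hI : Inst.Derivable T Ξ Θ Γ (fun β x => I β x.prev) :=
      ih (fun o m x => hobj o m x.prev) (fun o m x => heq o m x.prev)
    intro β x
    cases x with
    | last =>
      obtain ⟨o | o, m⟩ := α
      · exact hobj o m .last
      · exact heq o m .last (hI.der hB)
    | prev x => exact hI β x

/-- Object premises are weakened from `Θ` to the residue; each equality premise is an instance of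
the metavariable rule for the metavariable that the residue adds for it. -/
theorem Inst.residual_derivable {Ξ : MCtx S μ} (hΞ : Ξ.WF T) {Θ : MCtx S ν} {I : Inst S μ ν 0}
    (hobj : ∀ (o : Obj) (m : ℕ) (x : MVar μ ⟨.obj o, m⟩),
      Der T Θ .nil (.jdg (((Ξ.bdry x).act (I.upto x) Fin.elim0).plug (I _ x)))) :
    I.residual.Derivable T Ξ (Θ.residue Ξ I) .nil := by
  have hB : ∀ {α} (x : MVar μ α),
      ((Ξ.bdry x).act (I.upto x) Fin.elim0).act (fun γ y => (MVar.toResidue μ γ y).genapp)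
        Fin.elim0 = (Ξ.bdry x).act (I.residual.upto x) Fin.elim0 := by
    intro α x
    rw [Bdry.act_act_closed, Inst.upto_act, ← residual_eq_act]
  refine derivable_of_wf hΞ (fun o m x => ?_) (fun o m x hx => ?_)
  · have := (hobj o m x).renameMv (Θ := Θ.residue Ξ I)
      fun α x => MCtx.lookup_toResidue Θ Ξ I x
    rw [Stmt.act, Bdry.plug_act, hB] at this
    rw [residual_eq_act] at this ⊢
    exact this
  · obtain ⟨y, hy⟩ := MCtx.exists_lookup_residue Θ Ξ I x
    rw [Bdry.renameMv_eq_act, Subsingleton.elim Expr.var (Fin.elim0 : Fin 0 → Tm S _ 0), hB] at hy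
    rw [← hy] at hx ⊢
    exact Der.eqMv y hx _

/-! ### Rules whose head is a pattern -/

theorem RawRule.deterministic_of_isPattern {Ξ : MCtx S μ} {o : Obj} {B : Bdry S μ 0 ⟨.obj o, 0⟩}
    {q : Expr S μ 0 ⟨.obj o, 0⟩} {k : PatKind} (hq : IsPattern k q) (hmv : q.mvs = objMvs μ) :
    (⟨μ, Ξ, .obj o, B, q⟩ : RawRule S).Deterministic := by
  intro ν _ n _ J I I' h h'
  have hI : q.act I Fin.elim0 = q.act I' Fin.elim0 := by
    have := h.trans h'.symm
    simp only [RawRule.concl, Bdry.plug_act] at this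
    cases B <;> simp_all [Bdry.act, Bdry.plug]
  funext α x
  obtain ⟨o' | o', m⟩ := α
  · exact hq.act_inj hI ⟨_, x⟩ (hmv ▸ ⟨o', rfl⟩)
  · exact Subsingleton.elim _ _

theorem RawRule.objInvertible_of_isPattern (hT : T.IsStandard) {Ξ : MCtx S μ} (hΞ : Ξ.WF T)
    {o : Obj} {B : Bdry S μ 0 ⟨.obj o, 0⟩} {q : Expr S μ 0 ⟨.obj o, 0⟩} {k : PatKind}
    (hq : IsPattern k q) (hmv : q.mvs = objMvs μ) (hn : Natural T Ξ .nil (B.plug q))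
    (hd : Der T Ξ .nil (.jdg (B.plug q))) :
    (⟨μ, Ξ, .obj o, B, q⟩ : RawRule S).ObjInvertible T := by
  refine ⟨hd, fun ν Θ I _ hI => Inst.residual_derivable hΞ fun o' m x => ?_⟩
  simp only [RawRule.concl, Bdry.plug_act] at hI
  exact hq.der_premise hT hn hI ⟨_, x⟩ (hmv ▸ ⟨o', rfl⟩)

end Patterns

end FTT

/-! ### The proposition for type patterns and for term patterns. -/

theorem mainTheorem4 {S : FTT.Signature} (T : FTT.RawTheory S) (hT : T.IsStandard) :
    (∀ {μ : FTT.Shape} (Ξ : FTT.MCtx S μ) (P B : FTT.Ty S μ 0),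
      (FTT.RawRule.eqTy Ξ P B).Derivable T → (FTT.RawRule.eqTy Ξ P B).Finitary T →
      FTT.IsPattern .type P → P.mvs = FTT.objMvs μ →
      FTT.Natural T Ξ .nil (.isTy P) →
      FTT.IsTypeCompRule T Ξ P B) ∧
    (∀ {μ : FTT.Shape} (Ξ : FTT.MCtx S μ) (p w : FTT.Tm S μ 0) (A : FTT.Ty S μ 0),
      (FTT.RawRule.eqTm Ξ p w A).Derivable T → (FTT.RawRule.eqTm Ξ p w A).Finitary T →
      FTT.IsPattern .term p → p.mvs = FTT.objMvs μ →
      FTT.Natural T Ξ .nil (.hasTy p (hT.natTy Ξ .nil p)) →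
      FTT.IsTermCompRule hT Ξ p w A) := by
  constructor
  · intro μ Ξ P B hd hf hP hmv hn
    refine ⟨hd, hf, FTT.RawRule.deterministic_of_isPattern hP hmv, ?_⟩
    obtain ⟨hΞ, hB⟩ := hf
    -- Finitarity of the equation contains the derivability of its left-hand side.
    cases hB with | bdryEqTy hP' _ =>
    exact FTT.RawRule.objInvertible_of_isPattern hT hΞ (B := .ty) hP hmv hn hP'
  · intro μ Ξ p w A hd hf hp hmv hn
    obtain ⟨s, es, rfl⟩ : ∃ (s : S.Sym .tm) (es : FTT.Inst S (S.args s) μ 0), p = .sym s es := by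
      cases hp with | termSym s es => exact ⟨s, es, rfl⟩
    refine ⟨hd, hf, ⟨s, es, rfl⟩, FTT.RawRule.deterministic_of_isPattern hp hmv, ?_⟩
    obtain ⟨hΞ, hB⟩ := hf
    -- The boundary types `p` at `A`; `Der.natTy` moves it to its natural type, where naturality is
    -- assumed.
    cases hB with | bdryEqTm _ hp' _ =>
    exact FTT.RawRule.objInvertible_of_isPattern hT hΞ (B := .tm _) hp hmv hn (hp'.natTy hT)
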